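/- **Theorem (Contextual Safety Bound).** All norms are Euclidean (unless said otherwise), $\mathrm{dist}(u,S)=\inf_{v\in S}\|u-v\|$, and time runs over $t=0,\dots,T$. *Environment.* Let $\mathcal U\subseteq\mathbb R^m$ ($m\ge1$), $\mathcal X\subseteq\mathbb R^n$, let $\mathcal X_{\mathrm{safe}}\subseteq\mathcal X$ be compact, and let $f_t$ be $C^2$ on $\mathcal X\times\mathcal U$. The states satisfy $x_t\in\mathcal X$ and $x_{t+1}=f_t(x_t,u_t)$, and $\mathcal M_t=\{u\in\mathcal U: f_t(x_t,u)\in\mathcal X_{\mathrm{safe}}\}$ is assumed compact. The Planner sees a context $\xi_t\in\mathbb R^d$ ($d\ge 0$; $d=0$ is the case without context). *Data.* For each $t$ let $J_t$ be a joint probability density of (action, context) on $\mathbb R^m\times\mathbb R^d$ that is $L_J$-Lipschitz and vanishes outside the closed ball of radius $R$ about $0$ (Lipschitz constant and radius with respect to $\|(u,\xi)\|=\max(\|u\|,\|\xi\|)$), with context density $\pi_t(\xi)=\int J_t(v,\xi)\,dv$, and assume $\pi_t(\xi_t)\ge\pi_{\min}>0$. The conditional oracle density $p^*_t(\cdot\mid\xi_t)=J_t(\cdot,\xi_t)/\pi_t(\xi_t)$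 is assumed to be an oracle feasibility density of $\mathcal M_t$: it is continuous, $C^2$ and positive on $\mathrm{int}\,\mathcal M_t$, and zero elsewhere. For each $t$ let $(U_{t,i},\Xi_{t,i})_{i\ge 1}$ be i.i.d. with density $J_t$ (no independence between different $t$ is assumed; the streams may coincide). From the first $N_t\ge1$ pairs the Simulator forms the conditional Gaussian product-kernel estimate $$\hat p_t(u\mid\xi_t)=\frac{\hat p_t(u,\xi_t)}{\int\hat p_t(v,\xi_t)\,dv},\qquad \hat p_t(u,\xi)=\frac1{N_t}\sum_{i\le N_t}K_{h_u}(u-U_{t,i})\,K_{h_\xi}(\xi-\Xi_{t,i}),\qquad K_h(z)=\frac{e^{-\|z\|^2/(2h^2)}}{(2\pi h^2)^{\dim z/2}},$$ where the bandwidths $h_u,h_\xi$ are deterministic functions of $N=N_t$ with values in $[a N^{-1/(m+d+4)},\,b N^{-1/(m+d+4)}]$, $0<a\le b$. *Learned geometry.* For $\alpha>0$ let $\hat{\mathcal M}_t^\alpha$ be a connected component of $\{u:\hat p_t(u\mid\xi_t)\ge\alpha\}$. Let $\kappa(\xi_t)$ and $\Lambda_t$ be the largest and smallest constants with $\kappa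 I\preceq-\nabla_u^2\ln\hat p_t(u\mid\xi_t)\preceq\Lambda I$ on $\hat{\mathcal M}_t^\alpha$, let $\bar u_t$ be the maximizer of $\hat p_t(\cdot\mid\xi_t)$ on $\hat{\mathcal M}_t^\alpha$, let $r_{\alpha,t}=\mathrm{dist}(\bar u_t,\partial\hat{\mathcal M}_t^\alpha)$, and let $u_t^*$ be the minimizer over $\hat{\mathcal M}_t^\alpha$ of the free energy $\mathcal F_t(u)=c_t(u)-\beta_t\ln\hat p_t(u\mid\xi_t)$. Put $L_t=L_c+\beta_t\Lambda_t$, $\chi_t=L_t/(\beta_t\kappa(\xi_t))$ and $\rho_{K,t}=\sqrt{\chi_t}\,(1-1/\chi_t)^{K/2}$. The output $u_t$, $1\le t\le T$, of contextual PPC is obtained by $K$ gradient steps $u\mapsto u-L_t^{-1}\bigl(\nabla c_t(u)-\beta_t\nabla_u\ln\hat p_t(u\mid\xi_t)\bigr)$ started at $u_{t-1}$; the initial action $u_0$ is given. *Assumptions,* for every $t$: 1. $\hat{\mathcal M}_t^\alpha$ is convex, $\kappa(\xi_t)>0$ and $\Lambda_t<\infty$; the cost $c_t$ is convex on $\mathcal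 U$, differentiable at the points of $\mathcal U$, and on $\mathcal U$ its gradient is $L_c$-Lipschitz ($L_c\ge0$) and bounded by $G_c$; 2. $r_{\alpha,t}>0$ and $\beta_t>G_c/(\kappa(\xi_t)\,r_{\alpha,t})$; 3. there are $c_{\partial}>0$ and $0<r_{\partial}\le\tau$ (they may depend on $t$) such that $\partial\mathcal M_t$ has reach at least $\tau$ and $\langle\nabla_u p^*_t(u\mid\xi_t),\hat n(u)\rangle\ge c_\partial$ for all $u\in\mathrm{int}\,\mathcal M_t$ with $\mathrm{dist}(u,\partial\mathcal M_t)\le r_\partial$, where $\hat n(u)$ is the inward unit normal at the boundary point nearest to $u$, i.e. the unit vector from that point to $u$; moreover $\sqrt{\epsilon_t}<\alpha$ and $(\alpha+\sqrt{\epsilon_t})/c_\partial\le r_\partial$, where $\epsilon_t:=C/N_t^{2/(m+d+4)}$. *Conclusion.* For every $\delta\in(0,1)$ there is a constant $C_0>0$, depending only on $m,d,T,\delta,L_J,R,\pi_{\min},a,b$, such that with probability at least $1-\delta$ over the samples the following holds for all $C\ge C_0$ and simultaneously for all sample counts $N_t$, dynamics, states, contexts, costs, stiffnesses, thresholds and actions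 satisfying the above (so these may depend on the samples). (a) Suppose the warm-start margin holds: for some $R^*>0$ with $R^*\le r_{\alpha,t}-G_c/(\beta_t\kappa(\xi_t))$ for all $t$, one has $\|u_0-u_0^*\|\le R^*/2$ and $\|u^*_t-u^*_{t-1}\|\le R^*/2$ for $1\le t\le T$. Suppose also that $K$ is large enough that $\rho_{K,t}\le 1/2$ for $1\le t\le T$. Then for every $1\le t\le T$ $$\mathrm{dist}(u_t,\mathcal M_t)\;\le\;\frac{\sqrt{\epsilon_t}+\alpha}{c_\partial}+\frac{G_c}{\beta_t\,\kappa(\xi_t)} .$$ (b) For arbitrary $K\ge0$ and any $1\le t\le T$ such that the warm start lies in the attraction ball, i.e. $u_{t-1}\in\hat{\mathcal M}_t^\alpha$ and $\|u_{t-1}-u_t^*\|\le\mathrm{dist}(u_t^*,\partial\hat{\mathcal M}_t^\alpha)$, one has $$\mathrm{dist}(u_t,\mathcal M_t)\;\le\;\frac{\sqrt{\epsilon_t}+\alpha}{c_\partial}+\frac{G_c}{\beta_t\,\kappa(\xi_t)}+\rho_{K,t}\,\mathrm{diam}(\hat{\mathcal M}_t^\alpha).$$ -/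

import Mathlib

open MeasureTheory ProbabilityTheory
open scoped RealInnerProductSpace

namespace PPC

/-- Column vectors with the Euclidean norm. -/
abbrev Vec (k : ℕ) : Type := EuclideanSpace ℝ (Fin k)

noncomputable section

/-! ### Kernel density estimation -/

/-- The Gaussian kernel `exp (-‖z‖² / (2 h²)) / (2 π h²) ^ (k / 2)` on `ℝᵏ`. -/
def gaussianKernel {k : ℕ} (h : ℝ) (z : Vec k) : ℝ :=
  Real.exp (-‖z‖ ^ 2 / (2 * h ^ 2)) / (2 * Real.pi * h ^ 2) ^ ((k : ℝ) / 2)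

/-- The product-kernel estimate of the joint density of (action, context), built from the first
`N` pairs of the sample stream `s`. -/
def jointKDE {m d : ℕ} (s : ℕ → Vec m × Vec d) (N : ℕ) (hu hξ : ℝ) (u : Vec m) (ξ : Vec d) : ℝ :=
  (1 / (N : ℝ)) * ∑ i ∈ Finset.range N,
    gaussianKernel hu (u - (s i).1) * gaussianKernel hξ (ξ - (s i).2)

/-- The learned conditional density of the action given the context. For `d = 0` this is the plain
Gaussian kernel density estimate of the action density. -/
def condKDE {m d : ℕ} (s : ℕ → Vec m × Vec d) (N : ℕ) (hu hξ : ℝ) (ξ : Vec d) (u : Vec m) : ℝ :=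
  jointKDE s N hu hξ u ξ / ∫ v : Vec m, jointKDE s N hu hξ v ξ

/-- Bandwidths of exact order `N ^ (-1 / (k + 4))`, where `k` is the dimension of the data. -/
def IsBandwidth (k : ℕ) (a b : ℝ) (h : ℕ → ℝ) : Prop :=
  ∀ N : ℕ, 1 ≤ N →
    a * (N : ℝ) ^ (-(1 : ℝ) / ((k : ℝ) + 4)) ≤ h N ∧
    h N ≤ b * (N : ℝ) ^ (-(1 : ℝ) / ((k : ℝ) + 4))

/-- The error rate `ε = C / N ^ (2 / (k + 4))`, where `k` is the dimension of the data. -/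
def errorRate (k : ℕ) (C : ℝ) (N : ℕ) : ℝ :=
  C / (N : ℝ) ^ ((2 : ℝ) / ((k : ℝ) + 4))

/-! ### The oracle law -/

/-- A joint probability density of (action, context) that is `L`-Lipschitz and vanishes outside the
closed ball of radius `R`. -/
structure IsJointOracleDensity {m d : ℕ} (J : Vec m × Vec d → ℝ) (L R : ℝ) : Prop where
  nonneg : ∀ z, 0 ≤ J z
  integral_eq_one : ∫ z, J z = 1
  lipschitz : ∀ z w, |J z - J w| ≤ L * ‖z - w‖
  support : ∀ z, R < ‖z‖ → J z = 0

/-- The density of the context. -/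
def contextDensity {m d : ℕ} (J : Vec m × Vec d → ℝ) (ξ : Vec d) : ℝ :=
  ∫ v : Vec m, J (v, ξ)

/-- The conditional oracle density of the action given the context. -/
def condDensity {m d : ℕ} (J : Vec m × Vec d → ℝ) (ξ : Vec d) (u : Vec m) : ℝ :=
  J (u, ξ) / contextDensity J ξ

/-- The pairs `s 0, s 1, …` are independent and each has the density `J`. -/
structure IsSampleStream {m d : ℕ} {Ω : Type*} [MeasurableSpace Ω] (μ : Measure Ω)
    (s : ℕ → Ω → Vec m × Vec d) (J : Vec m × Vec d → ℝ) : Prop where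
  measurable : ∀ i, Measurable (s i)
  indep : iIndepFun s μ
  law : ∀ i, μ.map (s i) =
    (volume : Measure (Vec m × Vec d)).withDensity (fun z => ENNReal.ofReal (J z))

/-! ### The feasibility manifold and its oracle density -/

/-- The admissible controls that lead from the state `x` into the safe set. -/
def feasibleSet {n m : ℕ} (U : Set (Vec m)) (f : Vec n → Vec m → Vec n) (Xsafe : Set (Vec n))
    (x : Vec n) : Set (Vec m) :=
  {u | u ∈ U ∧ f x u ∈ Xsafe}

/-- `p` is an oracle feasibility density of `M`: twice continuously differentiable and positive in
the interior, and vanishing continuously on the boundary and outside. -/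
structure IsFeasibilityDensity {m : ℕ} (p : Vec m → ℝ) (M : Set (Vec m)) : Prop where
  continuous : Continuous p
  contDiffOn : ContDiffOn ℝ 2 p (interior M)
  pos : ∀ u ∈ interior M, 0 < p u
  eq_zero : ∀ u, u ∉ interior M → p u = 0

/-- `S` has reach at least `τ`: every point closer than `τ` to `S` has a unique nearest point. -/
def HasReach {m : ℕ} (S : Set (Vec m)) (τ : ℝ) : Prop :=
  ∀ u, Metric.infDist u S < τ → ∃! b, b ∈ S ∧ dist u b = Metric.infDist u S

/-- The inward-normal derivative of `p` is at least `c` at the interior points of `M` within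
distance `r` of the boundary. The inward unit normal at the boundary point `b` nearest to an
interior point `u` is `(u - b) / ‖u - b‖`. -/
def InwardNondegenerate {m : ℕ} (p : Vec m → ℝ) (M : Set (Vec m)) (c r : ℝ) : Prop :=
  ∀ u ∈ interior M, Metric.infDist u (frontier M) ≤ r →
    ∀ b ∈ frontier M, dist u b = Metric.infDist u (frontier M) →
      c ≤ ⟪gradient p u, ‖u - b‖⁻¹ • (u - b)⟫

/-! ### Barrier curvature and score descent -/

/-- The score `∇ ln p`. -/
def score {m : ℕ} (p : Vec m → ℝ) (u : Vec m) : Vec m :=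
  gradient (fun v => Real.log (p v)) u

/-- The local Fisher information `-∇² ln p (u)`, as a bilinear form. -/
def fisher {m : ℕ} (p : Vec m → ℝ) (u v w : Vec m) : ℝ :=
  -(fderiv ℝ (fderiv ℝ (fun z => Real.log (p z))) u v w)

/-- The values of the quadratic form of the Fisher information at unit vectors, over `S`. -/
def fisherRange {m : ℕ} (p : Vec m → ℝ) (S : Set (Vec m)) : Set ℝ :=
  {r | ∃ u ∈ S, ∃ v : Vec m, ‖v‖ = 1 ∧ r = fisher p u v v}

/-- The barrier curvature `κ`: the infimum over `S` of the least eigenvalue of the Fisher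
information. -/
def barrierCurvature {m : ℕ} (p : Vec m → ℝ) (S : Set (Vec m)) : ℝ := sInf (fisherRange p S)

/-- The curvature upper bound `Λ`: the supremum over `S` of the largest eigenvalue of the Fisher
information. -/
def curvatureUpper {m : ℕ} (p : Vec m → ℝ) (S : Set (Vec m)) : ℝ := sSup (fisherRange p S)

/-- The free energy `c - β ln p`. -/
def freeEnergy {m : ℕ} (c : Vec m → ℝ) (β : ℝ) (p : Vec m → ℝ) (u : Vec m) : ℝ :=
  c u - β * Real.log (p u)

/-- The smoothness constant `L_c + β Λ` of the free energy. -/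
def smoothness {m : ℕ} (p : Vec m → ℝ) (S : Set (Vec m)) (β Lc : ℝ) : ℝ :=
  Lc + β * curvatureUpper p S

/-- The condition number `χ = (L_c + β Λ) / (β κ)`. -/
def condNumber {m : ℕ} (p : Vec m → ℝ) (S : Set (Vec m)) (β Lc : ℝ) : ℝ :=
  smoothness p S β Lc / (β * barrierCurvature p S)

/-- The contraction factor `ρ_K = √χ (1 - 1/χ) ^ (K / 2)`. -/
def contractionFactor {m : ℕ} (p : Vec m → ℝ) (S : Set (Vec m)) (β Lc : ℝ) (K : ℕ) : ℝ :=
  Real.sqrt (condNumber p S β Lc) * (1 - 1 / condNumber p S β Lc) ^ ((K : ℝ) / 2)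

/-- One gradient step `u - η (∇c - β ŝ)` on the free energy. -/
def ppcStep {m : ℕ} (c : Vec m → ℝ) (β : ℝ) (p : Vec m → ℝ) (η : ℝ) (u : Vec m) : Vec m :=
  u - η • (gradient c u - β • score p u)

/-- `K` gradient steps with step size `1 / (L_c + β Λ)`, started at `u`. -/
def ppcOutput {m : ℕ} (c : Vec m → ℝ) (β : ℝ) (p : Vec m → ℝ) (S : Set (Vec m)) (Lc : ℝ) (K : ℕ)
    (u : Vec m) : Vec m :=
  (ppcStep c β p (1 / smoothness p S β Lc))^[K] u

/-- `c` is convex, `L_c`-smooth and has gradient bounded by `G_c` on `U`. -/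
structure IsSmoothConvexCost {m : ℕ} (c : Vec m → ℝ) (U : Set (Vec m)) (Lc Gc : ℝ) : Prop where
  convex : ConvexOn ℝ U c
  differentiable : ∀ u ∈ U, DifferentiableAt ℝ c u
  smooth : ∀ u ∈ U, ∀ v ∈ U, ‖gradient c u - gradient c v‖ ≤ Lc * ‖u - v‖
  grad_bound : ∀ u ∈ U, ‖gradient c u‖ ≤ Gc

/-- Local log-concavity of the learned density `p`: `S` is a convex connected component of
the superlevel set `{p ≥ α}`, on which the Fisher information is bounded above (`Λ < ∞`) and
bounded below by a positive constant (`κ > 0`). -/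
structure IsLocallyLogConcave {m : ℕ} (p : Vec m → ℝ) (α : ℝ) (S : Set (Vec m)) : Prop where
  component : ∃ z ∈ {u | α ≤ p u}, S = connectedComponentIn {u | α ≤ p u} z
  convex : Convex ℝ S
  curvature_pos : 0 < barrierCurvature p S
  upper_finite : BddAbove (fisherRange p S)

/-- The level-set radius `r_α`: the distance from the density peak to the boundary of the learned
set. -/
def levelRadius {m : ℕ} (S : Set (Vec m)) (ubar : Vec m) : ℝ := Metric.infDist ubar (frontier S)

/-- The critical stiffness `β*_curv = G_c / (κ r_α)`. -/
def criticalStiffness {m : ℕ} (p : Vec m → ℝ) (S : Set (Vec m)) (ubar : Vec m) (Gc : ℝ) : ℝ :=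
  Gc / (barrierCurvature p S * levelRadius S ubar)

/-- The interior margin `r_α - G_c / (β κ)`. -/
def interiorMargin {m : ℕ} (p : Vec m → ℝ) (S : Set (Vec m)) (ubar : Vec m) (β Gc : ℝ) : ℝ :=
  levelRadius S ubar - Gc / (β * barrierCurvature p S)

/-- The safety bound `(√ε + α) / c_∂ + G_c / (β κ)`. -/
def safetyBound {m : ℕ} (p : Vec m → ℝ) (S : Set (Vec m)) (ε α cb β Gc : ℝ) : ℝ :=
  (Real.sqrt ε + α) / cb + Gc / (β * barrierCurvature p S)

end

end PPC

/-!
The proof rests on the fact that, on a good event, the learned basin is contained in the interior of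
the feasible set. The distance of any action in the basin to the feasible set is then zero, and the
bounds follow from their nonnegativity once the output of the gradient descent is known to stay in
the basin.

*Statistics.* An action outside the interior of the feasible set has oracle density zero. It is
enough that at every such action, for every context of density at least `πmin` and every sample
size, the learned density is at most `√C₀ N ^ (-1 / (k + 4))`, where `k = m + d`; this is less than
`α`. For a Lipschitz density and bandwidths of order `w = N ^ (-1 / (k + 4))` the bias is of order
`w`. A kernel of height `B` of order `w ^ (-k)` has second moment of order `B`, so the exponential
moment with parameter `w / B` bounds the probability of a deviation of order `w` by
`exp (-Q / w ^ 2)`, with `Q` as large as desired (`measure_sum_ge_le`). This beats the polynomial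
size of a grid on which the Lipschitz kernels are controlled (`exists_uniform_deviation_event`,
`exists_net_prod`) and remains summable over all `N` (`exists_exponent`). The quotient defining the
conditional estimate is treated in `exists_safe_event`.

*Optimization.* On the basin the free energy is `β κ`-strongly convex and `(L_c + β Λ)`-smooth, in
the sense of quadratic Taylor bounds (`IsBasin.isQuadBounded_freeEnergy`). Comparing the quadratic
growth of the free energy and of `-ln p` around their minimizers places the minimizer of the free
energy within `G_c / (β κ)` of the density peak, hence in the interior of the basin
(`IsBasin.norm_peak_sub_minimizer_le`). A gradient step from a point of a ball around the minimizer
that lies in the basin remains in that ball and contracts the distance (`IsQuadBounded.step`). With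
a warm-start margin, the distance to the current minimizer is at most half the margin at all times,
by induction.
-/

namespace PPC

/-! ### Quadratic bounds along segments -/

/-- Integration of the bound `φ' ≤ φ' 0 + a s` over `[0, 1]`. -/
lemma le_quadratic_of_deriv_le {φ φ' : ℝ → ℝ} {a : ℝ}
    (h : ∀ s ∈ Set.Icc (0 : ℝ) 1, HasDerivAt φ (φ' s) s)
    (ha : ∀ s ∈ Set.Icc (0 : ℝ) 1, φ' s ≤ φ' 0 + a * s) :
    φ 1 ≤ φ 0 + φ' 0 + a / 2 := by
  set ψ : ℝ → ℝ := fun s => φ s - (φ' 0 * s + a / 2 * s ^ 2) with hψ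
  have hd : ∀ s ∈ Set.Icc (0 : ℝ) 1, HasDerivAt ψ (φ' s - (φ' 0 + a * s)) s := by
    intro s hs
    have h2 : HasDerivAt (fun s : ℝ => φ' 0 * s + a / 2 * s ^ 2) (φ' 0 + a * s) s := by
      have := ((hasDerivAt_id s).const_mul (φ' 0)).add (((hasDerivAt_pow 2 s)).const_mul (a / 2))
      refine this.congr_deriv ?_
      simp; ring
    exact (h s hs).sub h2
  have hanti : AntitoneOn ψ (Set.Icc 0 1) := by
    refine antitoneOn_of_deriv_nonpos (convex_Icc 0 1)
      (fun s hs => (hd s hs).continuousAt.continuousWithinAt) ?_ ?_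
    · intro s hs
      exact (hd s (interior_subset hs)).differentiableAt.differentiableWithinAt
    · intro s hs
      rw [(hd s (interior_subset hs)).deriv]
      linarith [ha s (interior_subset hs)]
  have := hanti (Set.left_mem_Icc.2 zero_le_one) (Set.right_mem_Icc.2 zero_le_one) zero_le_one
  simp only [hψ] at this
  linarith

/-- The second-order Taylor bound on `[0, 1]` from an upper bound of the second derivative. -/
lemma le_quadratic_of_deriv2_le {φ φ' φ'' : ℝ → ℝ} {a : ℝ}
    (h : ∀ s ∈ Set.Icc (0 : ℝ) 1, HasDerivAt φ (φ' s) s)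
    (h' : ∀ s ∈ Set.Icc (0 : ℝ) 1, HasDerivAt φ' (φ'' s) s)
    (ha : ∀ s ∈ Set.Icc (0 : ℝ) 1, φ'' s ≤ a) :
    φ 1 ≤ φ 0 + φ' 0 + a / 2 := by
  refine le_quadratic_of_deriv_le h fun s hs => ?_
  set ψ : ℝ → ℝ := fun s => φ' s - a * s with hψ
  have hd : ∀ s ∈ Set.Icc (0 : ℝ) 1, HasDerivAt ψ (φ'' s - a) s := by
    intro s hs
    have h2 : HasDerivAt (fun s : ℝ => a * s) a s := by
      simpa using (hasDerivAt_id s).const_mul a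
    exact (h' s hs).sub h2
  have hanti : AntitoneOn ψ (Set.Icc 0 1) := by
    refine antitoneOn_of_deriv_nonpos (convex_Icc 0 1)
      (fun s hs => (hd s hs).continuousAt.continuousWithinAt) ?_ ?_
    · intro s hs
      exact (hd s (interior_subset hs)).differentiableAt.differentiableWithinAt
    · intro s hs
      rw [(hd s (interior_subset hs)).deriv]
      linarith [ha s (interior_subset hs)]
  have := hanti (Set.left_mem_Icc.2 zero_le_one) hs hs.1
  simp only [hψ] at this
  linarith

lemma hasDerivAt_comp_segment {m : ℕ} {f : Vec m → ℝ} {x v : Vec m} {s : ℝ}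
    (hf : DifferentiableAt ℝ f (x + s • v)) :
    HasDerivAt (fun r : ℝ => f (x + r • v)) ⟪gradient f (x + s • v), v⟫ s := by
  have h1 : HasDerivAt (fun r : ℝ => x + r • v) v s := by
    simpa using ((hasDerivAt_id s).smul_const v).const_add x
  have h2 := hf.hasFDerivAt.comp_hasDerivAt s h1
  have h3 : fderiv ℝ f (x + s • v) v = ⟪gradient f (x + s • v), v⟫ := by
    rw [gradient, InnerProductSpace.toDual_symm_apply]
  rw [← h3]; exact h2

lemma add_smul_sub_mem {m : ℕ} {S : Set (Vec m)} (hS : Convex ℝ S) {x y : Vec m} (hx : x ∈ S)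
    (hy : y ∈ S) {s : ℝ} (hs : s ∈ Set.Icc (0 : ℝ) 1) : x + s • (y - x) ∈ S :=
  hS.add_smul_sub_mem hx hy hs

/-- The quadratic upper and lower Taylor bounds for `f` with gradient field `g` on `S`: for a
differentiable `f` this is strong convexity with constant `μ` and smoothness with constant `L`. -/
structure IsQuadBounded {m : ℕ} (f : Vec m → ℝ) (g : Vec m → Vec m) (S : Set (Vec m))
    (μ L : ℝ) : Prop where
  lower : ∀ x ∈ S, ∀ y ∈ S, f x + ⟪g x, y - x⟫ + μ / 2 * ‖y - x‖ ^ 2 ≤ f y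
  upper : ∀ x ∈ S, ∀ y ∈ S, f y ≤ f x + ⟪g x, y - x⟫ + L / 2 * ‖y - x‖ ^ 2

lemma IsQuadBounded.mono {m : ℕ} {f : Vec m → ℝ} {g : Vec m → Vec m} {S S' : Set (Vec m)}
    {μ L : ℝ} (h : IsQuadBounded f g S μ L) (hS : S' ⊆ S) : IsQuadBounded f g S' μ L :=
  ⟨fun x hx y hy => h.lower x (hS hx) y (hS hy), fun x hx y hy => h.upper x (hS hx) y (hS hy)⟩

lemma IsQuadBounded.add_smul {m : ℕ} {f f' : Vec m → ℝ} {g g' : Vec m → Vec m} {S : Set (Vec m)}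
    {μ L μ' L' β : ℝ} (hβ : 0 ≤ β) (h : IsQuadBounded f g S μ L)
    (h' : IsQuadBounded f' g' S μ' L') :
    IsQuadBounded (fun u => f u + β * f' u) (fun u => g u + β • g' u) S (μ + β * μ')
      (L + β * L') := by
  constructor
  · intro x hx y hy
    have h1 := h.lower x hx y hy
    have h2 := mul_le_mul_of_nonneg_left (h'.lower x hx y hy) hβ
    simp only [inner_add_left, real_inner_smul_left]
    nlinarith
  · intro x hx y hy
    have h1 := h.upper x hx y hy
    have h2 := mul_le_mul_of_nonneg_left (h'.upper x hx y hy) hβ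
    simp only [inner_add_left, real_inner_smul_left]
    nlinarith

lemma isQuadBounded_cost {m : ℕ} {c : Vec m → ℝ} {U S : Set (Vec m)} {Lc Gc : ℝ}
    (hc : IsSmoothConvexCost c U Lc Gc) (hS : Convex ℝ S) (hSU : S ⊆ U) :
    IsQuadBounded c (gradient c) S 0 Lc := by
  have hmem : ∀ x ∈ S, ∀ y ∈ S, ∀ s ∈ Set.Icc (0 : ℝ) 1, x + s • (y - x) ∈ U :=
    fun x hx y hy s hs => hSU (add_smul_sub_mem hS hx hy hs)
  constructor
  · intro x hx y hy
    have hd := hasDerivAt_comp_segment (f := c) (x := x) (v := y - x) (s := 0)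
      (hc.differentiable _ (by simpa using hSU hx))
    have hconv : ConvexOn ℝ (Set.Icc (0 : ℝ) 1) (fun r : ℝ => c (x + r • (y - x))) := by
      have h1 := (hc.convex.subset hSU hS).comp_affineMap (AffineMap.lineMap (k := ℝ) x y)
      have h2 : ConvexOn ℝ (Set.Icc (0 : ℝ) 1) (c ∘ (AffineMap.lineMap (k := ℝ) x y)) := by
        refine h1.subset (fun s hs => ?_) (convex_Icc 0 1)
        have := add_smul_sub_mem hS hx hy hs
        simp only [Set.mem_preimage, AffineMap.lineMap_apply, vsub_eq_sub, vadd_eq_add]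
        rwa [add_comm]
      refine h2.congr fun s _ => ?_
      simp [AffineMap.lineMap_apply, add_comm]
    have h3 := hconv.le_slope_of_hasDerivAt (Set.left_mem_Icc.2 zero_le_one)
      (Set.right_mem_Icc.2 zero_le_one) zero_lt_one hd
    simp [slope_def_field] at h3
    simp
    linarith
  · intro x hx y hy
    have h := le_quadratic_of_deriv_le (φ := fun r : ℝ => c (x + r • (y - x)))
      (φ' := fun s => ⟪gradient c (x + s • (y - x)), y - x⟫) (a := Lc * ‖y - x‖ ^ 2)
      (fun s hs => hasDerivAt_comp_segment (hc.differentiable _ (hmem x hx y hy s hs))) ?_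
    · simp only [one_smul, zero_smul, add_zero, add_sub_cancel] at h
      linarith
    · intro s hs
      have h1 := hc.smooth _ (hmem x hx y hy s hs) x (hSU hx)
      have h2 := real_inner_le_norm (gradient c (x + s • (y - x)) - gradient c x) (y - x)
      rw [inner_sub_left] at h2
      have h3 : ‖x + s • (y - x) - x‖ = s * ‖y - x‖ := by
        rw [add_sub_cancel_left, norm_smul, Real.norm_of_nonneg hs.1]
      rw [h3] at h1
      have h4 := mul_le_mul_of_nonneg_right h1 (norm_nonneg (y - x))
      simp only [zero_smul, add_zero]
      nlinarith

/-- A bound on the Fisher information of a positive `C²` density over a convex set turns into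
quadratic bounds of its negative logarithm. -/
lemma isQuadBounded_neg_log {m : ℕ} {p : Vec m → ℝ} {S : Set (Vec m)} {κ Λ : ℝ}
    (hp : ContDiff ℝ 2 p) (hpos : ∀ u, 0 < p u) (hS : Convex ℝ S)
    (hκ : ∀ u ∈ S, ∀ v : Vec m, κ * ‖v‖ ^ 2 ≤ fisher p u v v)
    (hΛ : ∀ u ∈ S, ∀ v : Vec m, fisher p u v v ≤ Λ * ‖v‖ ^ 2) :
    IsQuadBounded (fun u => -Real.log (p u)) (fun u => -score p u) S κ Λ := by
  have hl : ContDiff ℝ 2 (fun u => Real.log (p u)) := hp.log fun u => (hpos u).ne'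
  have hl1 : Differentiable ℝ (fun u => Real.log (p u)) := hl.differentiable (by norm_num)
  have hl2 : Differentiable ℝ (fderiv ℝ (fun u => Real.log (p u))) :=
    (hl.fderiv_right (m := 1) (by norm_num)).differentiable (by norm_num)
  have hd1 : ∀ x v : Vec m, ∀ s : ℝ, HasDerivAt (fun r : ℝ => Real.log (p (x + r • v)))
      ⟪score p (x + s • v), v⟫ s := fun x v s => hasDerivAt_comp_segment (hl1 _)
  have hd2 : ∀ x v : Vec m, ∀ s : ℝ, HasDerivAt (fun r : ℝ => ⟪score p (x + r • v), v⟫)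
      (-fisher p (x + s • v) v v) s := by
    intro x v s
    have h1 : HasDerivAt (fun r : ℝ => x + r • v) v s := by
      simpa using ((hasDerivAt_id s).smul_const v).const_add x
    have h2 : HasDerivAt (fun r : ℝ => fderiv ℝ (fun u => Real.log (p u)) (x + r • v))
        (fderiv ℝ (fderiv ℝ (fun u => Real.log (p u))) (x + s • v) v) s :=
      (hl2 (x + s • v)).hasFDerivAt.comp_hasDerivAt s h1
    have h4 : HasDerivAt (fun r : ℝ => fderiv ℝ (fun u => Real.log (p u)) (x + r • v) v)
        (fderiv ℝ (fderiv ℝ (fun u => Real.log (p u))) (x + s • v) v v) s := by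
      simpa using HasDerivAt.clm_apply h2 (hasDerivAt_const s v)
    have h3 : ∀ r : ℝ, ⟪score p (x + r • v), v⟫
        = fderiv ℝ (fun u => Real.log (p u)) (x + r • v) v := by
      intro r
      rw [score, gradient, InnerProductSpace.toDual_symm_apply]
    simp only [h3, fisher, neg_neg]
    exact h4
  constructor
  · intro x hx y hy
    have h := le_quadratic_of_deriv2_le (a := -(κ * ‖y - x‖ ^ 2))
      (fun s _ => hd1 x (y - x) s) (fun s _ => hd2 x (y - x) s)
      (fun s hs => neg_le_neg (hκ _ (add_smul_sub_mem hS hx hy hs) _))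
    simp only [one_smul, zero_smul, add_zero, add_sub_cancel] at h
    simp only [inner_neg_left]
    linarith
  · intro x hx y hy
    have h := le_quadratic_of_deriv2_le (φ := fun s => -Real.log (p (x + s • (y - x))))
      (φ' := fun s => -⟪score p (x + s • (y - x)), y - x⟫) (a := Λ * ‖y - x‖ ^ 2)
      (fun s _ => (hd1 x (y - x) s).neg) (fun s _ => (hd2 x (y - x) s).neg)
      (fun s hs => by
        rw [neg_neg]; exact hΛ _ (add_smul_sub_mem hS hx hy hs) _)
    simp only [one_smul, zero_smul, add_zero, add_sub_cancel] at h
    simp only [inner_neg_left]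
    linarith

lemma fisher_smul {m : ℕ} (p : Vec m → ℝ) (u v : Vec m) (r : ℝ) :
    fisher p u (r • v) (r • v) = r ^ 2 * fisher p u v v := by
  simp [fisher]; ring

lemma fisherRange_nonempty {m : ℕ} (hm : 0 < m) (p : Vec m → ℝ) {S : Set (Vec m)} {u : Vec m}
    (hu : u ∈ S) : (fisherRange p S).Nonempty :=
  ⟨_, u, hu, EuclideanSpace.single ⟨0, hm⟩ 1, by simp, rfl⟩

/-- A positive curvature is not the junk infimum `0` of a set that is unbounded below. -/
lemma bddBelow_fisherRange {m : ℕ} {p : Vec m → ℝ} {S : Set (Vec m)}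
    (h : 0 < barrierCurvature p S) : BddBelow (fisherRange p S) := by
  by_contra hb
  rw [barrierCurvature, Real.sInf_of_not_bddBelow hb] at h
  exact lt_irrefl _ h

/-- The quadratic form of the Fisher information lies between `κ` and `Λ` times the squared
norm. -/
lemma fisher_mem_bounds {m : ℕ} {p : Vec m → ℝ} {S : Set (Vec m)}
    (h : 0 < barrierCurvature p S) (hb : BddAbove (fisherRange p S)) {u : Vec m} (hu : u ∈ S)
    (v : Vec m) :
    barrierCurvature p S * ‖v‖ ^ 2 ≤ fisher p u v v ∧
      fisher p u v v ≤ curvatureUpper p S * ‖v‖ ^ 2 := by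
  rcases eq_or_ne v 0 with rfl | hv
  · simp [fisher]
  · have hv' : ‖v‖ ≠ 0 := norm_ne_zero_iff.2 hv
    have hmem : fisher p u (‖v‖⁻¹ • v) (‖v‖⁻¹ • v) ∈ fisherRange p S :=
      ⟨u, hu, ‖v‖⁻¹ • v, by rw [norm_smul, norm_inv, norm_norm, inv_mul_cancel₀ hv'], rfl⟩
    have heq : fisher p u v v = fisher p u (‖v‖⁻¹ • v) (‖v‖⁻¹ • v) * ‖v‖ ^ 2 := by
      rw [fisher_smul]; field_simp
    rw [heq]
    exact ⟨mul_le_mul_of_nonneg_right (csInf_le (bddBelow_fisherRange h) hmem) (sq_nonneg _),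
      mul_le_mul_of_nonneg_right (le_csSup hb hmem) (sq_nonneg _)⟩

/-! ### Gradient descent on a ball -/

/-- If `0 ≤ s b + s² a` for all small positive `s`, then `0 ≤ b`. -/
lemma nonneg_of_forall_small {a b r : ℝ} (hr : 0 < r)
    (h : ∀ s, 0 < s → s ≤ r → 0 ≤ s * b + s ^ 2 * a) : 0 ≤ b := by
  by_contra hb
  push Not at hb
  have ha : 0 < |a| + 1 := by positivity
  set s := min r (-b / (2 * (|a| + 1))) with hs
  have hs0 : 0 < s := lt_min hr (div_pos (by linarith) (by positivity))
  have h1 := h s hs0 (min_le_left _ _)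
  have h2 : s * (2 * (|a| + 1)) ≤ -b := by
    have := min_le_right r (-b / (2 * (|a| + 1)))
    rwa [← hs, le_div_iff₀ (by positivity)] at this
  have h3 : 0 ≤ b + s * a := by
    have h5 : 0 ≤ s * (b + s * a) := by nlinarith
    exact nonneg_of_mul_nonneg_right h5 hs0
  nlinarith [le_abs_self a, mul_le_mul_of_nonneg_left (le_abs_self a) hs0.le]

/-- Quadratic growth around a constrained minimizer. -/
lemma IsQuadBounded.growth {m : ℕ} {f : Vec m → ℝ} {g : Vec m → Vec m} {S : Set (Vec m)}
    {μ L : ℝ} (h : IsQuadBounded f g S μ L) (hS : Convex ℝ S) {x y : Vec m} (hx : x ∈ S)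
    (hmin : IsMinOn f S x) (hy : y ∈ S) : f x + μ / 2 * ‖y - x‖ ^ 2 ≤ f y := by
  have h0 : 0 ≤ ⟪g x, y - x⟫ := by
    refine nonneg_of_forall_small (a := L / 2 * ‖y - x‖ ^ 2) zero_lt_one fun s hs0 hs1 => ?_
    have hz := add_smul_sub_mem hS hx hy ⟨hs0.le, hs1⟩
    have h1 := h.upper x hx _ hz
    have h2 : f x ≤ f (x + s • (y - x)) := hmin hz
    rw [add_sub_cancel_left, real_inner_smul_right, norm_smul, mul_pow, Real.norm_eq_abs,
      sq_abs] at h1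
    nlinarith
  linarith [h.lower x hx y hy]

/-- A gradient step of length `1 / L` towards a minimizer `x` over a ball stays in that ball and
contracts the squared distance to `x` by `1 - μ / L`. The bound `1 - s μ` holds for each `s ≤ 1 / L`
for which the step of length `s` stays in the ball; the first return to the sphere would contradict
it, so the step of length `1 / L` does not leave the ball. -/
lemma IsQuadBounded.step {m : ℕ} {f : Vec m → ℝ} {g : Vec m → Vec m} {x : Vec m} {r μ L : ℝ}
    (hr : 0 < r) (hμ : 0 < μ) (hL : 0 < L) (h : IsQuadBounded f g (Metric.closedBall x r) μ L)
    (hmin : IsMinOn f (Metric.closedBall x r) x) {u : Vec m} (hu : ‖u - x‖ ≤ r) :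
    ‖u - (1 / L) • g u - x‖ ^ 2 ≤ (1 - μ / L) * ‖u - x‖ ^ 2 := by
  have hxB : x ∈ Metric.closedBall x r := Metric.mem_closedBall_self hr.le
  have huB : u ∈ Metric.closedBall x r := by rwa [mem_closedBall_iff_norm]
  have hexp : ∀ s : ℝ, ‖u - s • g u - x‖ ^ 2
      = ‖u - x‖ ^ 2 - 2 * s * ⟪g u, u - x⟫ + s ^ 2 * ‖g u‖ ^ 2 := by
    intro s
    have : u - s • g u - x = (u - x) - s • g u := by abel
    rw [this, norm_sub_sq_real, real_inner_smul_right, norm_smul, mul_pow, Real.norm_eq_abs,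
      sq_abs, real_inner_comm]
    ring
  -- the contraction for every step length that stays in the ball
  have hkey : ∀ s : ℝ, 0 ≤ s → s ≤ 1 / L → ‖u - s • g u - x‖ ≤ r →
      ‖u - s • g u - x‖ ^ 2 ≤ (1 - s * μ) * ‖u - x‖ ^ 2 := by
    intro s hs0 hs1 hsB
    have hsB' : u - s • g u ∈ Metric.closedBall x r := by rwa [mem_closedBall_iff_norm]
    have h1 := h.upper u huB _ hsB'
    have h2 : f x ≤ f (u - s • g u) := hmin hsB'
    have h3 := h.lower u huB x hxB
    have e1 : u - s • g u - u = -(s • g u) := by abel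
    rw [e1, inner_neg_right, real_inner_smul_right, real_inner_self_eq_norm_sq, norm_neg,
      norm_smul, mul_pow, Real.norm_eq_abs, sq_abs] at h1
    have e2 : x - u = -(u - x) := by abel
    rw [e2, inner_neg_right, norm_neg] at h3
    have h4 : L * s ≤ 1 := by
      rw [le_div_iff₀ hL] at hs1; linarith
    have h5 : L * s * (s * ‖g u‖ ^ 2) ≤ 1 * (s * ‖g u‖ ^ 2) :=
      mul_le_mul_of_nonneg_right h4 (by positivity)
    have h6 : s / 2 * ‖g u‖ ^ 2 + μ / 2 * ‖u - x‖ ^ 2 ≤ ⟪g u, u - x⟫ := by nlinarith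
    rw [hexp]
    nlinarith [mul_le_mul_of_nonneg_left h6 hs0]
  have hsuff : ‖u - (1 / L) • g u - x‖ ^ 2 ≤ ‖u - x‖ ^ 2 := by
    rcases eq_or_ne u x with rfl | hne
    · -- at the minimizer the gradient vanishes
      have hg : ‖g u‖ ^ 2 ≤ 0 := by
        have := nonneg_of_forall_small (a := L / 2 * ‖g u‖ ^ 2) (b := -‖g u‖ ^ 2)
          (r := r / (‖g u‖ + 1)) (by positivity) fun s hs0 hs1 => ?_
        · linarith
        · have hsB : u - s • g u ∈ Metric.closedBall u r := by
            rw [mem_closedBall_iff_norm, sub_sub_cancel_left, norm_neg, norm_smul,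
              Real.norm_of_nonneg hs0.le]
            rw [le_div_iff₀ (by positivity)] at hs1
            nlinarith [norm_nonneg (g u)]
          have h1 := h.upper u huB _ hsB
          have h2 : f u ≤ f (u - s • g u) := hmin hsB
          have e1 : u - s • g u - u = -(s • g u) := by abel
          rw [e1, inner_neg_right, real_inner_smul_right, real_inner_self_eq_norm_sq, norm_neg,
            norm_smul, mul_pow, Real.norm_eq_abs, sq_abs] at h1
          nlinarith
      have hg0 : g u = 0 := by
        have : ‖g u‖ = 0 := by nlinarith [norm_nonneg (g u)]
        exact norm_eq_zero.1 this
      simp [hg0]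
    · have hA : 0 < ‖u - x‖ ^ 2 := by
        have := norm_pos_iff.2 (sub_ne_zero.2 hne)
        positivity
      by_contra hcon
      push Not at hcon
      have hb : 0 < ⟪g u, u - x⟫ := by
        have h3 := h.lower u huB x hxB
        have h2 : f x ≤ f u := hmin huB
        have e2 : x - u = -(u - x) := by abel
        rw [e2, inner_neg_right, norm_neg] at h3
        nlinarith
      rw [hexp] at hcon
      have hG : 0 < ‖g u‖ ^ 2 := by
        by_contra hG
        have h0 : ‖g u‖ ^ 2 = 0 := le_antisymm (not_lt.1 hG) (sq_nonneg _)
        rw [h0] at hcon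
        have : 0 < 1 / L * ⟪g u, u - x⟫ := by positivity
        nlinarith
      -- the positive length at which the ray returns to the sphere through `u`
      set s := 2 * ⟪g u, u - x⟫ / ‖g u‖ ^ 2 with hs
      have hs0 : 0 < s := by positivity
      have hsG : s * ‖g u‖ ^ 2 = 2 * ⟪g u, u - x⟫ := by
        rw [hs, div_mul_cancel₀ _ hG.ne']
      have hsq : ‖u - s • g u - x‖ ^ 2 = ‖u - x‖ ^ 2 := by rw [hexp]; nlinarith
      have hs1 : s ≤ 1 / L := by
        rw [hs, div_le_iff₀ hG]
        have h0 : 0 < 1 / L := by positivity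
        have : 0 < 1 / L * (1 / L * ‖g u‖ ^ 2 - 2 * ⟪g u, u - x⟫) := by nlinarith
        have := (mul_pos_iff_of_pos_left h0).1 this
        linarith
      have hnorm : ‖u - s • g u - x‖ = ‖u - x‖ :=
        (sq_eq_sq₀ (norm_nonneg _) (norm_nonneg _)).1 hsq
      have := hkey s hs0.le hs1 (hnorm.le.trans hu)
      rw [hsq] at this
      nlinarith [mul_pos (mul_pos hs0 hμ) hA]
  have hB : ‖u - (1 / L) • g u - x‖ ≤ r :=
    (pow_le_pow_iff_left₀ (norm_nonneg _) (norm_nonneg _) two_ne_zero).1 hsuff |>.trans hu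
  have := hkey (1 / L) (by positivity) le_rfl hB
  rwa [one_div_mul_eq_div] at this

lemma IsQuadBounded.iterate {m : ℕ} {f : Vec m → ℝ} {g : Vec m → Vec m} {x : Vec m} {r μ L : ℝ}
    (hr : 0 < r) (hμ : 0 < μ) (hL : 0 < L) (hμL : μ ≤ L)
    (h : IsQuadBounded f g (Metric.closedBall x r) μ L)
    (hmin : IsMinOn f (Metric.closedBall x r) x) {u : Vec m} (hu : ‖u - x‖ ≤ r) (K : ℕ) :
    ‖(fun v => v - (1 / L) • g v)^[K] u - x‖ ^ 2 ≤ (1 - μ / L) ^ K * ‖u - x‖ ^ 2 := by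
  have hq0 : 0 ≤ 1 - μ / L := sub_nonneg.2 ((div_le_one hL).2 hμL)
  have hq1 : 1 - μ / L ≤ 1 := by
    have : 0 < μ / L := by positivity
    linarith
  induction K with
  | zero => simp
  | succ K ih =>
    rw [Function.iterate_succ_apply']
    have hle : ‖(fun v => v - (1 / L) • g v)^[K] u - x‖ ≤ r := by
      refine le_trans ?_ hu
      refine (pow_le_pow_iff_left₀ (norm_nonneg _) (norm_nonneg _) two_ne_zero).1 ?_
      refine ih.trans (mul_le_of_le_one_left (sq_nonneg _) (pow_le_one₀ hq0 hq1))
    have h1 := h.step hr hμ hL hmin hle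
    calc _ ≤ _ := h1
      _ ≤ (1 - μ / L) * ((1 - μ / L) ^ K * ‖u - x‖ ^ 2) := mul_le_mul_of_nonneg_left ih hq0
      _ = _ := by ring

lemma closedBall_infDist_frontier_subset {m : ℕ} {S : Set (Vec m)} (hS : IsClosed S) {x : Vec m}
    (hx : x ∈ S) : Metric.closedBall x (Metric.infDist x (frontier S)) ⊆ S := by
  rcases eq_or_ne S Set.univ with rfl | hne
  · exact Set.subset_univ _
  obtain ⟨y, hy, hxy⟩ := exists_mem_frontier_infDist_compl_eq_dist hx hne
  have hle : Metric.infDist x (frontier S) ≤ Metric.infDist x Sᶜ :=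
    hxy ▸ Metric.infDist_le_dist_of_mem hy
  rcases eq_or_ne (Metric.infDist x (frontier S)) 0 with h0 | h0
  · rw [h0, Metric.closedBall_zero]
    exact Set.singleton_subset_iff.2 hx
  · rw [← closure_ball x h0]
    exact closure_minimal ((Metric.ball_subset_ball hle).trans Metric.ball_infDist_compl_subset) hS


/-! ### Geometry of the learned basin -/

/-- The data of one time step on a convex learned basin `S` on which the cost is controlled. -/
structure IsBasin {m : ℕ} (p c : Vec m → ℝ) (α β Lc Gc : ℝ) (S U : Set (Vec m))
    (ubar ustar : Vec m) : Prop where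
  contDiff : ContDiff ℝ 2 p
  pos : ∀ u, 0 < p u
  concave : IsLocallyLogConcave p α S
  cost : IsSmoothConvexCost c U Lc Gc
  subset : S ⊆ U
  peak : ubar ∈ S ∧ IsMaxOn p S ubar
  minimizer : ustar ∈ S ∧ IsMinOn (freeEnergy c β p) S ustar
  radius_pos : 0 < levelRadius S ubar
  stiff : criticalStiffness p S ubar Gc < β

namespace IsBasin

variable {m : ℕ} {p c : Vec m → ℝ} {α β Lc Gc : ℝ} {S U : Set (Vec m)} {ubar ustar : Vec m}

lemma bound_nonneg (h : IsBasin p c α β Lc Gc S U ubar ustar) : 0 ≤ Gc :=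
  (norm_nonneg _).trans (h.cost.grad_bound _ (h.subset h.peak.1))

lemma stiffness_pos (h : IsBasin p c α β Lc Gc S U ubar ustar) : 0 < β :=
  lt_of_le_of_lt (div_nonneg h.bound_nonneg
    (mul_pos h.concave.curvature_pos h.radius_pos).le) h.stiff

lemma isClosed (h : IsBasin p c α β Lc Gc S U ubar ustar) : IsClosed S := by
  obtain ⟨z, hz, rfl⟩ := h.concave.component
  rw [connectedComponentIn_eq_image hz]
  exact (isClosed_le continuous_const h.contDiff.continuous).isClosedMap_subtype_val _
    isClosed_connectedComponent

lemma curvature_le (hm : 0 < m) (h : IsBasin p c α β Lc Gc S U ubar ustar) :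
    barrierCurvature p S ≤ curvatureUpper p S :=
  csInf_le_csSup (fisherRange_nonempty hm p h.peak.1) (bddBelow_fisherRange h.concave.curvature_pos)
    h.concave.upper_finite

lemma isQuadBounded_neg_log (h : IsBasin p c α β Lc Gc S U ubar ustar) :
    IsQuadBounded (fun u => -Real.log (p u)) (fun u => -score p u) S (barrierCurvature p S)
      (curvatureUpper p S) :=
  PPC.isQuadBounded_neg_log h.contDiff h.pos h.concave.convex
    (fun _ hu v => (fisher_mem_bounds h.concave.curvature_pos h.concave.upper_finite hu v).1)
    (fun _ hu v => (fisher_mem_bounds h.concave.curvature_pos h.concave.upper_finite hu v).2)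

/-- The free energy is strongly convex and smooth on the basin. -/
lemma isQuadBounded_freeEnergy (h : IsBasin p c α β Lc Gc S U ubar ustar) :
    IsQuadBounded (freeEnergy c β p) (fun u => gradient c u - β • score p u) S
      (β * barrierCurvature p S) (smoothness p S β Lc) := by
  have h1 := (isQuadBounded_cost h.cost h.concave.convex h.subset).add_smul h.stiffness_pos.le
    h.isQuadBounded_neg_log
  have e1 : (fun u => c u + β * -Real.log (p u)) = freeEnergy c β p := by
    funext u; simp [freeEnergy]; ring
  have e2 : (fun u => gradient c u + β • -score p u) = fun u => gradient c u - β • score p u := by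
    funext u; rw [smul_neg, sub_eq_add_neg]
  rwa [e1, e2, zero_add] at h1

/-- The bounded cost gradient displaces the minimizer of the free energy from the density peak by
at most `G_c / (β κ)`: both the free energy and `-ln p` grow quadratically from their minimizers. -/
lemma norm_peak_sub_minimizer_le (h : IsBasin p c α β Lc Gc S U ubar ustar) :
    ‖ubar - ustar‖ ≤ Gc / (β * barrierCurvature p S) := by
  have hκ := h.concave.curvature_pos
  have hβ := h.stiffness_pos
  have h1 := h.isQuadBounded_freeEnergy.growth h.concave.convex h.minimizer.1 h.minimizer.2
    h.peak.1
  have hmin : IsMinOn (fun u => -Real.log (p u)) S ubar := fun u hu =>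
    neg_le_neg (Real.log_le_log (h.pos u) (h.peak.2 hu))
  have h2 := h.isQuadBounded_neg_log.growth h.concave.convex h.peak.1 hmin h.minimizer.1
  have h3 := (isQuadBounded_cost h.cost h.concave.convex h.subset).lower _ h.peak.1 _
    h.minimizer.1
  have h4 := neg_le_of_abs_le ((abs_real_inner_le_norm (gradient c ubar) (ustar - ubar)).trans
    (mul_le_mul_of_nonneg_right (h.cost.grad_bound _ (h.subset h.peak.1)) (norm_nonneg _)))
  rw [norm_sub_rev ustar ubar] at h2 h3 h4
  simp only [freeEnergy] at h1
  rw [le_div_iff₀ (mul_pos hβ hκ)]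
  rcases (norm_nonneg (ubar - ustar)).eq_or_lt with h0 | h0
  · rw [← h0, zero_mul]; exact h.bound_nonneg
  · have h5 := mul_le_mul_of_nonneg_left h2 hβ.le
    have h6 : ‖ubar - ustar‖ * (β * barrierCurvature p S) * ‖ubar - ustar‖
        ≤ Gc * ‖ubar - ustar‖ := by nlinarith
    exact le_of_mul_le_mul_right h6 h0

lemma interiorMargin_pos (h : IsBasin p c α β Lc Gc S U ubar ustar) :
    0 < interiorMargin p S ubar β Gc := by
  have hκ := h.concave.curvature_pos
  have hβ := h.stiffness_pos
  have h1 := h.stiff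
  rw [criticalStiffness, div_lt_iff₀ (mul_pos hκ h.radius_pos)] at h1
  rw [interiorMargin, sub_pos, div_lt_iff₀ (mul_pos hβ hκ)]
  linarith

lemma interiorMargin_le_infDist (h : IsBasin p c α β Lc Gc S U ubar ustar) :
    interiorMargin p S ubar β Gc ≤ Metric.infDist ustar (frontier S) := by
  have h1 : levelRadius S ubar ≤ Metric.infDist ustar (frontier S) + dist ubar ustar :=
    Metric.infDist_le_infDist_add_dist
  rw [dist_eq_norm] at h1
  have h2 := h.norm_peak_sub_minimizer_le
  rw [interiorMargin]
  linarith

lemma contractionFactor_nonneg (hm : 0 < m) (hLc : 0 ≤ Lc)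
    (h : IsBasin p c α β Lc Gc S U ubar ustar) (K : ℕ) : 0 ≤ contractionFactor p S β Lc K := by
  have hκ := h.concave.curvature_pos
  have hβ := h.stiffness_pos
  have hχ : 1 ≤ condNumber p S β Lc := by
    rw [condNumber, one_le_div (mul_pos hβ hκ), smoothness]
    have := mul_le_mul_of_nonneg_left (h.curvature_le hm) hβ.le
    linarith
  refine mul_nonneg (Real.sqrt_nonneg _) (Real.rpow_nonneg (sub_nonneg.2 ?_) _)
  exact (div_le_one (by linarith)).2 hχ

/-- From a warm start in the attraction ball, gradient descent contracts the distance to the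
minimizer. -/
lemma norm_ppcOutput_sub_le (hm : 0 < m) (hLc : 0 ≤ Lc)
    (h : IsBasin p c α β Lc Gc S U ubar ustar) (K : ℕ) {u : Vec m}
    (hu : ‖u - ustar‖ ≤ Metric.infDist ustar (frontier S)) :
    ‖ppcOutput c β p S Lc K u - ustar‖ ≤ contractionFactor p S β Lc K * ‖u - ustar‖ ∧
      ‖ppcOutput c β p S Lc K u - ustar‖ ≤ Metric.infDist ustar (frontier S) := by
  have hκ := h.concave.curvature_pos
  have hβ := h.stiffness_pos
  set μ := β * barrierCurvature p S with hμ
  set L := smoothness p S β Lc with hL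
  have hμ0 : 0 < μ := mul_pos hβ hκ
  have hμL : μ ≤ L := by
    rw [hL, smoothness]
    have := mul_le_mul_of_nonneg_left (h.curvature_le hm) hβ.le
    linarith
  have hL0 : 0 < L := hμ0.trans_le hμL
  have hr := h.interiorMargin_pos.trans_le h.interiorMargin_le_infDist
  have hball := closedBall_infDist_frontier_subset h.isClosed h.minimizer.1
  have hit := (h.isQuadBounded_freeEnergy.mono hball).iterate hr hμ0 hL0 hμL
    (h.minimizer.2.on_subset hball) hu K
  change ‖ppcOutput c β p S Lc K u - ustar‖ ^ 2 ≤ _ at hit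
  have hq0 : 0 ≤ 1 - μ / L := sub_nonneg.2 ((div_le_one hL0).2 hμL)
  have hq1 : 1 - μ / L ≤ 1 := by
    have : 0 < μ / L := by positivity
    linarith
  have hχ : condNumber p S β Lc = L / μ := rfl
  have hχ1 : 1 ≤ L / μ := (one_le_div hμ0).2 hμL
  have hρ : contractionFactor p S β Lc K ^ 2 = L / μ * (1 - μ / L) ^ K := by
    rw [contractionFactor, hχ, mul_pow, Real.sq_sqrt (by linarith), one_div_div,
      ← Real.rpow_natCast _ 2, ← Real.rpow_mul hq0]
    norm_num
  constructor
  · refine (pow_le_pow_iff_left₀ (norm_nonneg _) (mul_nonneg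
      (h.contractionFactor_nonneg hm hLc K) (norm_nonneg _)) two_ne_zero).1 ?_
    rw [mul_pow, hρ]
    refine hit.trans (mul_le_mul_of_nonneg_right ?_ (sq_nonneg _))
    exact le_mul_of_one_le_left (pow_nonneg hq0 K) hχ1
  · refine le_trans ?_ hu
    refine (pow_le_pow_iff_left₀ (norm_nonneg _) (norm_nonneg _) two_ne_zero).1 ?_
    exact hit.trans (mul_le_of_le_one_left (sq_nonneg _) (pow_le_one₀ hq0 hq1))

lemma ppcOutput_mem (hm : 0 < m) (hLc : 0 ≤ Lc)
    (h : IsBasin p c α β Lc Gc S U ubar ustar) (K : ℕ) {u : Vec m}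
    (hu : ‖u - ustar‖ ≤ Metric.infDist ustar (frontier S)) :
    ppcOutput c β p S Lc K u ∈ S :=
  closedBall_infDist_frontier_subset h.isClosed h.minimizer.1
    (mem_closedBall_iff_norm.2 (h.norm_ppcOutput_sub_le hm hLc K hu).2)

lemma safetyBound_nonneg (h : IsBasin p c α β Lc Gc S U ubar ustar) {ε cb : ℝ} (hα : 0 < α)
    (hcb : 0 < cb) : 0 ≤ safetyBound p S ε α cb β Gc := by
  have hκ := h.concave.curvature_pos
  have hβ := h.stiffness_pos
  have hG := h.bound_nonneg
  rw [safetyBound]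
  positivity

end IsBasin

/-! ### The Gaussian kernel -/

section Kernel

variable {k : ℕ} {h : ℝ}

lemma gaussianKernel_eq (hh : 0 < h) (z : Vec k) :
    gaussianKernel h z
      = Real.exp (-(‖z‖ / h) ^ 2 / 2) * ((2 * Real.pi * h ^ 2) ^ ((k : ℝ) / 2))⁻¹ := by
  rw [gaussianKernel, div_eq_mul_inv]
  congr 2
  field_simp

lemma gaussianKernel_pos (hh : 0 < h) (z : Vec k) : 0 < gaussianKernel h z := by
  unfold gaussianKernel
  positivity

lemma contDiff_gaussianKernel (u₀ : Vec k) :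
    ContDiff ℝ 2 (fun u : Vec k => gaussianKernel h (u - u₀)) := by
  unfold gaussianKernel
  have : ContDiff ℝ 2 (fun u : Vec k => ‖u - u₀‖ ^ 2) := (contDiff_id.sub contDiff_const).norm_sq ℝ
  exact (this.neg.div_const _).exp.div_const _

lemma continuous_gaussianKernel : Continuous (gaussianKernel h : Vec k → ℝ) := by
  unfold gaussianKernel
  fun_prop

/-- The normalizing constant of the kernel is at least `h ^ k`, since `2 π ≥ 1`. -/
lemma inv_normalizer_le (k : ℕ) {q : ℝ} (hq : 0 < q) (hqh : q ≤ h) :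
    ((2 * Real.pi * h ^ 2) ^ ((k : ℝ) / 2))⁻¹ ≤ (q ^ k)⁻¹ := by
  apply inv_anti₀ (by positivity)
  have h1 : q ^ k = (q ^ 2) ^ ((k : ℝ) / 2) := by
    rw [← Real.rpow_natCast q 2, ← Real.rpow_mul hq.le, ← Real.rpow_natCast q k]
    congr 1; push_cast; ring
  rw [h1]
  apply Real.rpow_le_rpow (by positivity) _ (by positivity)
  have h2 : q ^ 2 ≤ h ^ 2 := by gcongr
  have h3 : (1 : ℝ) ≤ 2 * Real.pi := by linarith [Real.pi_gt_three]
  nlinarith [sq_nonneg h]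

lemma gaussianKernel_le {q : ℝ} (hq : 0 < q) (hqh : q ≤ h) (z : Vec k) :
    gaussianKernel h z ≤ (q ^ k)⁻¹ := by
  have hh : 0 < h := hq.trans_le hqh
  rw [gaussianKernel_eq hh]
  have h1 : Real.exp (-(‖z‖ / h) ^ 2 / 2) ≤ 1 := by
    rw [Real.exp_le_one_iff]
    nlinarith [sq_nonneg (‖z‖ / h)]
  calc _ ≤ 1 * (q ^ k)⁻¹ :=
        mul_le_mul h1 (inv_normalizer_le k hq hqh) (by positivity) zero_le_one
    _ = _ := one_mul _

lemma abs_exp_neg_sq_sub_le (x y : ℝ) :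
    |Real.exp (-x ^ 2 / 2) - Real.exp (-y ^ 2 / 2)| ≤ |x - y| := by
  have hd : ∀ r ∈ (Set.univ : Set ℝ), HasDerivWithinAt (fun r : ℝ => Real.exp (-r ^ 2 / 2))
      (Real.exp (-r ^ 2 / 2) * (-r)) Set.univ r := by
    intro r _
    have h1 : HasDerivAt (fun r : ℝ => -r ^ 2 / 2) (-r) r := by
      refine ((hasDerivAt_pow 2 r).neg.div_const 2).congr_deriv ?_
      simp; ring
    exact h1.exp.hasDerivWithinAt
  have hb : ∀ r ∈ (Set.univ : Set ℝ), ‖Real.exp (-r ^ 2 / 2) * (-r)‖ ≤ 1 := by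
    intro r _
    rw [norm_mul, norm_neg, Real.norm_eq_abs, Real.norm_eq_abs, Real.abs_exp]
    have h1 : |r| ≤ Real.exp (r ^ 2 / 2) := by
      have := Real.add_one_le_exp (r ^ 2 / 2)
      nlinarith [sq_nonneg (|r| - 1), sq_abs r]
    calc _ ≤ Real.exp (-r ^ 2 / 2) * Real.exp (r ^ 2 / 2) := by gcongr
      _ = 1 := by rw [← Real.exp_add]; simp [neg_div]
  have := convex_univ.norm_image_sub_le_of_norm_hasDerivWithin_le hd hb (Set.mem_univ y)
    (Set.mem_univ x)
  simpa using this

lemma abs_gaussianKernel_sub_le {q : ℝ} (hq : 0 < q) (hqh : q ≤ h) (z w : Vec k) :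
    |gaussianKernel h z - gaussianKernel h w| ≤ (q ^ (k + 1))⁻¹ * ‖z - w‖ := by
  have hh : 0 < h := hq.trans_le hqh
  rw [gaussianKernel_eq hh, gaussianKernel_eq hh, ← sub_mul, abs_mul]
  have h1 : |Real.exp (-(‖z‖ / h) ^ 2 / 2) - Real.exp (-(‖w‖ / h) ^ 2 / 2)| ≤ q⁻¹ * ‖z - w‖ := by
    refine (abs_exp_neg_sq_sub_le _ _).trans ?_
    rw [← sub_div, abs_div, abs_of_pos hh, div_eq_inv_mul]
    exact mul_le_mul (inv_anti₀ hq hqh) (abs_norm_sub_norm_le _ _) (abs_nonneg _) (by positivity)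
  have h2 := inv_normalizer_le k hq hqh
  rw [abs_of_pos (by positivity : (0:ℝ) < ((2 * Real.pi * h ^ 2) ^ ((k : ℝ) / 2))⁻¹)]
  calc _ ≤ q⁻¹ * ‖z - w‖ * (q ^ k)⁻¹ := mul_le_mul h1 h2 (by positivity) (by positivity)
    _ = _ := by rw [pow_succ, mul_inv]; ring

/-- A factor `‖z‖` costs a factor `h` and a doubling of the bandwidth. -/
lemma norm_mul_gaussianKernel_le (hh : 0 < h) (z : Vec k) :
    ‖z‖ * gaussianKernel h z ≤ h * 2 ^ k * gaussianKernel (2 * h) z := by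
  rw [gaussianKernel_eq hh, gaussianKernel_eq (by positivity)]
  set r := ‖z‖ / h with hr
  have e1 : ‖z‖ = h * r := by rw [hr]; field_simp
  have e2 : ‖z‖ / (2 * h) = r / 2 := by rw [hr]; field_simp
  have e3 : ((2 * Real.pi * (2 * h) ^ 2) ^ ((k : ℝ) / 2))⁻¹
      = (2 ^ k)⁻¹ * ((2 * Real.pi * h ^ 2) ^ ((k : ℝ) / 2))⁻¹ := by
    rw [← mul_inv]
    congr 1
    have : (2 : ℝ) * Real.pi * (2 * h) ^ 2 = 2 ^ 2 * (2 * Real.pi * h ^ 2) := by ring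
    rw [this, Real.mul_rpow (by positivity) (by positivity)]
    congr 1
    rw [← Real.rpow_natCast 2 2, ← Real.rpow_mul (by norm_num), ← Real.rpow_natCast 2 k]
    congr 1; push_cast; ring
  have h1 : r * Real.exp (-r ^ 2 / 2) ≤ Real.exp (-(r / 2) ^ 2 / 2) := by
    have h2 : r ≤ Real.exp (3 * r ^ 2 / 8) := by
      have := Real.add_one_le_exp (3 * r ^ 2 / 8)
      nlinarith [sq_nonneg (3 * r - 4)]
    calc _ ≤ Real.exp (3 * r ^ 2 / 8) * Real.exp (-r ^ 2 / 2) := by gcongr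
      _ = _ := by rw [← Real.exp_add]; congr 1; ring
  rw [e2, e3, e1]
  have h4 : (0 : ℝ) < ((2 * Real.pi * h ^ 2) ^ ((k : ℝ) / 2))⁻¹ := by positivity
  calc _ = h * (r * Real.exp (-r ^ 2 / 2)) * ((2 * Real.pi * h ^ 2) ^ ((k : ℝ) / 2))⁻¹ := by ring
    _ ≤ h * (Real.exp (-(r / 2) ^ 2 / 2)) * ((2 * Real.pi * h ^ 2) ^ ((k : ℝ) / 2))⁻¹ := by gcongr
    _ = _ := by field_simp

lemma integrable_gaussianKernel (hh : 0 < h) : Integrable (gaussianKernel h : Vec k → ℝ) := by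
  have h1 := (GaussianFourier.integrable_cexp_neg_mul_sq_norm_add (V := Vec k)
    (b := ((1 / (2 * h ^ 2) : ℝ) : ℂ)) (by rw [Complex.ofReal_re]; positivity) 0 0).re
  have h2 := h1.div_const ((2 * Real.pi * h ^ 2) ^ ((k : ℝ) / 2))
  refine h2.congr (Filter.Eventually.of_forall fun z => ?_)
  simp only [gaussianKernel]
  congr 1
  simp only [zero_mul, add_zero]
  rw [show -((1 / (2 * h ^ 2) : ℝ) : ℂ) * (‖z‖ : ℂ) ^ 2 = ((-‖z‖ ^ 2 / (2 * h ^ 2) : ℝ) : ℂ) by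
    push_cast; ring]
  exact Complex.exp_ofReal_re _

lemma integral_gaussianKernel (hh : 0 < h) : ∫ z : Vec k, gaussianKernel h z = 1 := by
  have h1 := GaussianFourier.integral_rexp_neg_mul_sq_norm (V := Vec k)
    (b := 1 / (2 * h ^ 2)) (by positivity)
  simp only [gaussianKernel]
  rw [integral_div]
  have e1 : ∀ z : Vec k, -‖z‖ ^ 2 / (2 * h ^ 2) = -(1 / (2 * h ^ 2)) * ‖z‖ ^ 2 := by
    intro z; ring
  simp only [e1, h1, finrank_euclideanSpace, Fintype.card_fin]
  have e2 : Real.pi / (1 / (2 * h ^ 2)) = 2 * Real.pi * h ^ 2 := by field_simp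
  rw [e2]
  exact div_self (by positivity)

lemma gaussianKernel_neg (z : Vec k) : gaussianKernel h (-z) = gaussianKernel h z := by
  simp [gaussianKernel]

lemma gaussianKernel_sub_comm (z w : Vec k) :
    gaussianKernel h (z - w) = gaussianKernel h (w - z) := by
  rw [← gaussianKernel_neg, neg_sub]

lemma integrable_gaussianKernel_sub (hh : 0 < h) (u : Vec k) :
    Integrable (fun v : Vec k => gaussianKernel h (v - u)) :=
  (integrable_gaussianKernel hh).comp_sub_right u

lemma integral_gaussianKernel_sub (hh : 0 < h) (u : Vec k) :
    ∫ v : Vec k, gaussianKernel h (v - u) = 1 := by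
  rw [integral_sub_right_eq_self (fun v : Vec k => gaussianKernel h v) u]
  exact integral_gaussianKernel hh

lemma integrable_gaussianKernel_sub' (hh : 0 < h) (u : Vec k) :
    Integrable (fun v : Vec k => gaussianKernel h (u - v)) := by
  simpa only [gaussianKernel_sub_comm u] using integrable_gaussianKernel_sub hh u

lemma integral_gaussianKernel_sub' (hh : 0 < h) (u : Vec k) :
    ∫ v : Vec k, gaussianKernel h (u - v) = 1 := by
  simpa only [gaussianKernel_sub_comm u] using integral_gaussianKernel_sub hh u

lemma gaussianKernel_le_of_norm_le (hh : 0 < h) {z w : Vec k} (hzw : ‖w‖ ≤ ‖z‖) :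
    gaussianKernel h z ≤ gaussianKernel h w := by
  unfold gaussianKernel
  gcongr

end Kernel

/-! ### The conditional kernel density estimate -/

section KDE

variable {m d : ℕ} {s : ℕ → Vec m × Vec d} {N : ℕ} {hu hξ : ℝ}

lemma integral_jointKDE (hhu : 0 < hu) (ξ : Vec d) :
    ∫ v : Vec m, jointKDE s N hu hξ v ξ
      = (1 / (N : ℝ)) * ∑ i ∈ Finset.range N, gaussianKernel hξ (ξ - (s i).2) := by
  simp only [jointKDE]
  rw [integral_const_mul, integral_finsetSum]
  · congr 1
    refine Finset.sum_congr rfl fun i _ => ?_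
    rw [integral_mul_const, integral_gaussianKernel_sub hhu, one_mul]
  · intro i _
    exact (integrable_gaussianKernel_sub hhu _).mul_const _

lemma integral_jointKDE_pos (hN : 1 ≤ N) (hhu : 0 < hu) (hhξ : 0 < hξ) (ξ : Vec d) :
    0 < ∫ v : Vec m, jointKDE s N hu hξ v ξ := by
  rw [integral_jointKDE hhu]
  have hN' : (0 : ℝ) < N := by exact_mod_cast hN
  refine mul_pos (by positivity) (Finset.sum_pos (fun i _ => gaussianKernel_pos hhξ _) ?_)
  exact Finset.nonempty_range_iff.2 (by omega)

lemma condKDE_pos (hN : 1 ≤ N) (hhu : 0 < hu) (hhξ : 0 < hξ) (ξ : Vec d) (u : Vec m) :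
    0 < condKDE s N hu hξ ξ u := by
  refine div_pos ?_ (integral_jointKDE_pos hN hhu hhξ ξ)
  have hN' : (0 : ℝ) < N := by exact_mod_cast hN
  refine mul_pos (by positivity) (Finset.sum_pos (fun i _ => mul_pos (gaussianKernel_pos hhu _)
    (gaussianKernel_pos hhξ _)) ?_)
  exact Finset.nonempty_range_iff.2 (by omega)

lemma contDiff_condKDE (ξ : Vec d) : ContDiff ℝ 2 (condKDE s N hu hξ ξ) := by
  unfold condKDE jointKDE
  refine ContDiff.div_const (contDiff_const.mul (ContDiff.sum fun i _ => ?_)) _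
  exact (contDiff_gaussianKernel _).mul contDiff_const

/-- The conditional estimate is a convex combination of kernels, hence at most the height of one
kernel. -/
lemma condKDE_le {q : ℝ} (hN : 1 ≤ N) (hq : 0 < q) (hqu : q ≤ hu) (hhξ : 0 < hξ) (ξ : Vec d)
    (u : Vec m) : condKDE s N hu hξ ξ u ≤ (q ^ m)⁻¹ := by
  have hhu := hq.trans_le hqu
  rw [condKDE, div_le_iff₀ (integral_jointKDE_pos hN hhu hhξ ξ), integral_jointKDE hhu, jointKDE,
    mul_left_comm, Finset.mul_sum _ _ (q ^ m)⁻¹]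
  have hN' : (0 : ℝ) ≤ 1 / (N : ℝ) := by positivity
  refine mul_le_mul_of_nonneg_left (Finset.sum_le_sum fun i _ => ?_) hN'
  exact mul_le_mul_of_nonneg_right (gaussianKernel_le hq hqu _) (gaussianKernel_pos hhξ _).le

end KDE

/-! ### An exponential deviation inequality -/

section Deviation

variable {Ω E : Type*} [MeasurableSpace Ω] [MeasurableSpace E] {μ : Measure Ω}
  [IsProbabilityMeasure μ] {Y : ℕ → Ω → E} {ν : Measure E} [IsProbabilityMeasure ν]

lemma mgf_le_exp {φ : E → ℝ} (hφ : Measurable φ) {B V l : ℝ} (hl : 0 ≤ l) (hB : ∀ y, |φ y| ≤ B)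
    (hlB : l * B ≤ 1) (hV : ∫ y, φ y ^ 2 ∂ν ≤ V) :
    mgf φ ν l ≤ Real.exp (l * (∫ y, φ y ∂ν) + l ^ 2 * V) := by
  have hi1 : Integrable φ ν := Integrable.of_bound hφ.aestronglyMeasurable B
    (Filter.Eventually.of_forall hB)
  have hi2 : Integrable (fun y => φ y ^ 2) ν :=
    Integrable.of_bound (hφ.pow_const 2).aestronglyMeasurable (B ^ 2)
      (Filter.Eventually.of_forall fun y => by
        rw [norm_pow]; exact pow_le_pow_left₀ (norm_nonneg _) (hB y) 2)
  have hlφ : ∀ y, |l * φ y| ≤ 1 := fun y => by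
    rw [abs_mul, abs_of_nonneg hl]
    exact (mul_le_mul_of_nonneg_left (hB y) hl).trans hlB
  have hpt : ∀ y, Real.exp (l * φ y) ≤ 1 + l * φ y + l ^ 2 * φ y ^ 2 := fun y => by
    have := le_of_abs_le (Real.abs_exp_sub_one_sub_id_le (hlφ y))
    nlinarith
  have hlin : Integrable (fun y => 1 + l * φ y) ν := (integrable_const 1).add (hi1.const_mul l)
  have hint : Integrable (fun y => 1 + l * φ y + l ^ 2 * φ y ^ 2) ν := hlin.add (hi2.const_mul _)
  have hexp : Integrable (fun y => Real.exp (l * φ y)) ν :=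
    Integrable.of_bound (by fun_prop) (Real.exp 1) (Filter.Eventually.of_forall fun y => by
      rw [Real.norm_eq_abs, Real.abs_exp]
      exact Real.exp_le_exp.2 (le_of_abs_le (hlφ y)))
  calc mgf φ ν l ≤ ∫ y, (1 + l * φ y + l ^ 2 * φ y ^ 2) ∂ν := integral_mono hexp hint hpt
    _ = 1 + l * (∫ y, φ y ∂ν) + l ^ 2 * ∫ y, φ y ^ 2 ∂ν := by
        rw [integral_add hlin (hi2.const_mul _),
          integral_add (integrable_const 1) (hi1.const_mul l), integral_const_mul,
          integral_const_mul]
        simp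
    _ ≤ l * (∫ y, φ y ∂ν) + l ^ 2 * V + 1 := by
        have := mul_le_mul_of_nonneg_left hV (sq_nonneg l)
        linarith
    _ ≤ _ := Real.add_one_le_exp _

/-- The one-sided Chernoff bound with a variance proxy: the exponent `w / B` balances a deviation of
order `w` against a second moment of order `B`. -/
lemma measure_sum_ge_le (hY : ∀ i, Measurable (Y i)) (hind : iIndepFun Y μ)
    (hlaw : ∀ i, μ.map (Y i) = ν) {φ : E → ℝ} (hφ : Measurable φ) {B V w A : ℝ} (hB0 : 0 < B)
    (hB : ∀ y, |φ y| ≤ B) (hw0 : 0 ≤ w) (hw1 : w ≤ 1) (hV : ∫ y, φ y ^ 2 ∂ν ≤ B * V) (N : ℕ) :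
    μ {ω | N * ((∫ y, φ y ∂ν) + A * w) ≤ ∑ i ∈ Finset.range N, φ (Y i ω)}
      ≤ ENNReal.ofReal (Real.exp (-((A - V) * (N * w ^ 2 / B)))) := by
  set e := ∫ y, φ y ∂ν with he
  set l := w / B with hl
  have hl0 : 0 ≤ l := by positivity
  have hlB : l * B = w := by rw [hl]; field_simp
  have hX : ∀ i, Measurable (fun ω => φ (Y i ω)) := fun i => hφ.comp (hY i)
  have hindX : iIndepFun (fun i ω => φ (Y i ω)) μ := hind.comp (fun _ => φ) fun _ => hφ
  have hmgf : ∀ i, mgf (fun ω => φ (Y i ω)) μ l ≤ Real.exp (l * e + l ^ 2 * (B * V)) := by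
    intro i
    have h1 : mgf (fun ω => φ (Y i ω)) μ l = mgf φ ν l := by
      rw [← hlaw i]
      exact (mgf_map (hY i).aemeasurable (by fun_prop)).symm
    rw [h1]
    exact mgf_le_exp hφ hl0 hB (hlB.trans_le hw1) hV
  have hsum : mgf (∑ i ∈ Finset.range N, fun ω => φ (Y i ω)) μ l
      ≤ Real.exp (l * e + l ^ 2 * (B * V)) ^ N := by
    rw [hindX.mgf_sum hX]
    calc _ ≤ ∏ i ∈ Finset.range N, Real.exp (l * e + l ^ 2 * (B * V)) :=
          Finset.prod_le_prod (fun _ _ => mgf_nonneg) fun i _ => hmgf i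
      _ = _ := by simp
  have hint : Integrable
      (fun ω => Real.exp (l * (∑ i ∈ Finset.range N, fun ω => φ (Y i ω)) ω)) μ := by
    refine Integrable.of_bound ?_ (Real.exp (l * (N * B))) (Filter.Eventually.of_forall fun ω => ?_)
    · have : Measurable (∑ i ∈ Finset.range N, fun ω => φ (Y i ω)) := by
        convert Finset.measurable_sum (Finset.range N) fun i _ => hX i using 1
        ext ω; simp
      fun_prop
    · rw [Real.norm_eq_abs, Real.abs_exp, Finset.sum_apply]
      refine Real.exp_le_exp.2 (mul_le_mul_of_nonneg_left ?_ hl0)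
      refine (Finset.sum_le_card_nsmul _ _ B fun i _ => le_of_abs_le (hB _)).trans ?_
      simp
  have hch := measure_ge_le_exp_mul_mgf (N * (e + A * w)) hl0 hint
  rw [← ofReal_measureReal]
  refine ENNReal.ofReal_le_ofReal ?_
  have hset : {ω | N * (e + A * w) ≤ ∑ i ∈ Finset.range N, φ (Y i ω)}
      = {ω | N * (e + A * w) ≤ (∑ i ∈ Finset.range N, fun ω => φ (Y i ω)) ω} := by
    ext ω; simp
  rw [hset]
  refine hch.trans ((mul_le_mul_of_nonneg_left hsum (Real.exp_pos _).le).trans_eq ?_)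
  rw [← Real.exp_nat_mul, ← Real.exp_add]
  congr 1
  rw [hl]
  field_simp
  ring

/-- Uniform deviations: outside a small event, the empirical means of a family that is Lipschitz in
its parameter exceed the true means by at most `A w + 2 Λ η`, simultaneously for all parameters that
lie within `η` of a given finite set. -/
lemma exists_uniform_deviation_event {Z : Type*} [PseudoMetricSpace Z] (hY : ∀ i, Measurable (Y i))
    (hind : iIndepFun Y μ) (hlaw : ∀ i, μ.map (Y i) = ν) {φ : Z → E → ℝ}
    (hφ : ∀ z, Measurable (φ z)) {B V w A Λ η : ℝ} (hB0 : 0 < B) (hB : ∀ z y, |φ z y| ≤ B)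
    (hw0 : 0 ≤ w) (hw1 : w ≤ 1) (hV : ∀ z, ∫ y, φ z y ^ 2 ∂ν ≤ B * V) (hΛ : 0 ≤ Λ)
    (hlip : ∀ z z' y, |φ z y - φ z' y| ≤ Λ * dist z z') {N : ℕ} (hN : 1 ≤ N) (G : Finset Z) :
    ∃ D : Set Ω, MeasurableSet D ∧
      μ D ≤ ENNReal.ofReal (G.card * Real.exp (-((A - V) * (N * w ^ 2 / B)))) ∧
      ∀ ω ∉ D, ∀ z, (∃ g ∈ G, dist z g ≤ η) →
        (1 / (N : ℝ)) * ∑ i ∈ Finset.range N, φ z (Y i ω)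
          ≤ (∫ y, φ z y ∂ν) + A * w + 2 * Λ * η := by
  refine ⟨⋃ g ∈ G, {ω | N * ((∫ y, φ g y ∂ν) + A * w) ≤ ∑ i ∈ Finset.range N, φ g (Y i ω)},
    ?_, ?_, ?_⟩
  · refine G.measurableSet_biUnion fun g _ => measurableSet_le measurable_const ?_
    exact Finset.measurable_sum _ fun i _ => (hφ g).comp (hY i)
  · refine (measure_biUnion_finset_le G _).trans ?_
    refine (Finset.sum_le_sum fun g _ => measure_sum_ge_le hY hind hlaw (hφ g) hB0 (hB g) hw0 hw1
      (hV g) N).trans_eq ?_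
    rw [Finset.sum_const, nsmul_eq_mul, ENNReal.ofReal_mul (Nat.cast_nonneg _),
      ENNReal.ofReal_natCast]
  · rintro ω hω z ⟨g, hg, hzg⟩
    have hN' : (0 : ℝ) < N := by exact_mod_cast hN
    simp only [Set.mem_iUnion, Set.mem_ofPred_eq, not_exists, not_le] at hω
    have h1 := hω g hg
    have hd : Λ * dist z g ≤ Λ * η := mul_le_mul_of_nonneg_left hzg hΛ
    have h2 : ∑ i ∈ Finset.range N, φ z (Y i ω)
        ≤ ∑ i ∈ Finset.range N, φ g (Y i ω) + N * (Λ * η) := by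
      have : ∑ i ∈ Finset.range N, φ z (Y i ω)
          ≤ ∑ i ∈ Finset.range N, (φ g (Y i ω) + Λ * η) :=
        Finset.sum_le_sum fun i _ => by linarith [le_of_abs_le (hlip z g (Y i ω))]
      simpa [Finset.sum_add_distrib] using this
    have hi : ∀ z, Integrable (φ z) ν := fun z =>
      Integrable.of_bound (hφ z).aestronglyMeasurable B (Filter.Eventually.of_forall (hB z))
    have h3 : ∫ y, φ g y ∂ν ≤ (∫ y, φ z y ∂ν) + Λ * η := by
      have : ∫ y, φ g y ∂ν ≤ ∫ y, (φ z y + Λ * η) ∂ν :=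
        integral_mono (hi g) ((hi z).add (integrable_const _)) fun y => by
          linarith [neg_le_of_abs_le (hlip z g y)]
      rw [integral_add (hi z) (integrable_const _)] at this
      simpa using this
    rw [one_div_mul_eq_div, div_le_iff₀ hN']
    nlinarith [mul_le_mul_of_nonneg_left h3 hN'.le]

end Deviation

/-! ### Finite nets of balls -/

/-- The cubic grid of mesh `η` gives nets of a Euclidean ball of polynomial size. -/
lemma exists_net (k : ℕ) (ρ : ℝ) : ∃ c : ℝ, 0 < c ∧ ∀ η : ℝ, 0 < η → η ≤ 1 →
    ∃ G : Finset (Vec k), (G.card : ℝ) ≤ c * (η ^ k)⁻¹ ∧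
      ∀ u : Vec k, ‖u‖ ≤ ρ → ∃ g ∈ G, dist u g ≤ η := by
  classical
  refine ⟨(2 * (|ρ| + 1) * (k + 1) + 3) ^ k, by positivity, fun η hη hη1 => ?_⟩
  -- a mesh `η / (k + 1)` in each coordinate
  set γ : ℝ := η / (k + 1) with hγ
  have hγ0 : 0 < γ := by positivity
  set M : ℕ := ⌈(|ρ| + 1) / γ⌉₊ with hM
  set I : Finset ℤ := Finset.Icc (-(M : ℤ)) M with hI
  set F : (Fin k → ℤ) → Vec k := fun j => WithLp.toLp 2 fun i => γ * (j i : ℝ) with hF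
  refine ⟨(Fintype.piFinset fun _ : Fin k => I).image F, ?_, ?_⟩
  · have h1 : ((Fintype.piFinset fun _ : Fin k => I).image F).card ≤ (2 * M + 1) ^ k := by
      refine Finset.card_image_le.trans_eq ?_
      rw [Fintype.card_piFinset_const, hI, Int.card_Icc]
      congr 1
      omega
    have h2 : (M : ℝ) ≤ (|ρ| + 1) / γ + 1 := (Nat.ceil_lt_add_one (by positivity)).le
    have h3 : (2 * (M : ℝ) + 1) ≤ (2 * (|ρ| + 1) * (k + 1) + 3) * η⁻¹ := by
      have e : (|ρ| + 1) / γ = (|ρ| + 1) * (k + 1) * η⁻¹ := by rw [hγ]; field_simp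
      have h4 : 1 ≤ η⁻¹ := (one_le_inv₀ hη).2 hη1
      rw [e] at h2
      nlinarith
    calc ((((Fintype.piFinset fun _ : Fin k => I).image F).card : ℕ) : ℝ)
        ≤ (((2 * M + 1) ^ k : ℕ) : ℝ) := by exact_mod_cast h1
      _ = (2 * (M : ℝ) + 1) ^ k := by push_cast; ring
      _ ≤ ((2 * (|ρ| + 1) * (k + 1) + 3) * η⁻¹) ^ k := by gcongr
      _ = _ := by rw [mul_pow, inv_pow]
  · intro u hu
    refine ⟨F fun i => ⌊u i / γ⌋,
      Finset.mem_image_of_mem _ (Fintype.mem_piFinset.2 fun i => ?_), ?_⟩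
    · have h1 : |u i| ≤ |ρ| := by
        have := PiLp.norm_apply_le u i
        rw [Real.norm_eq_abs] at this
        exact this.trans (hu.trans (le_abs_self ρ))
      have h2 : (|ρ| + 1) / γ ≤ M := Nat.le_ceil _
      have h3 : |u i / γ| ≤ |ρ| / γ := by
        rw [abs_div, abs_of_pos hγ0]; gcongr
      have h4 : 1 ≤ 1 / γ := by
        rw [one_le_div hγ0, hγ, div_le_one (by positivity)]
        have : (0 : ℝ) ≤ k := Nat.cast_nonneg k
        linarith
      rw [add_div] at h2
      rw [hI, Finset.mem_Icc, Int.le_floor, ← Int.cast_le (R := ℝ)]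
      push_cast
      exact ⟨by linarith [neg_le_of_abs_le h3], (Int.floor_le _).trans
        (by linarith [le_of_abs_le h3])⟩
    · rw [dist_eq_norm]
      have hco : ∀ i, ‖(u - F fun i => ⌊u i / γ⌋) i‖ ≤ γ := by
        intro i
        have h1 := Int.floor_le (u i / γ)
        have h2 := (Int.lt_floor_add_one (u i / γ)).le
        rw [le_div_iff₀ hγ0] at h1
        rw [div_le_iff₀ hγ0] at h2
        simp only [hF, PiLp.sub_apply, Real.norm_eq_abs]
        rw [abs_le]
        constructor <;> nlinarith
      rw [EuclideanSpace.norm_eq]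
      refine Real.sqrt_le_iff.2 ⟨hη.le, ?_⟩
      calc ∑ i, ‖(u - F fun i => ⌊u i / γ⌋) i‖ ^ 2 ≤ ∑ _i : Fin k, γ ^ 2 :=
            Finset.sum_le_sum fun i _ => by gcongr; exact hco i
        _ = k * γ ^ 2 := by simp
        _ ≤ η ^ 2 := by
            have e : η = γ * (k + 1) := by rw [hγ]; field_simp
            have : (0 : ℝ) ≤ k := Nat.cast_nonneg k
            rw [e]
            nlinarith [sq_nonneg γ, mul_nonneg (sq_nonneg γ) this,
              mul_nonneg (sq_nonneg γ) (mul_nonneg this this)]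

lemma exists_net_prod (m d : ℕ) (ρ : ℝ) : ∃ c : ℝ, 0 < c ∧ ∀ η : ℝ, 0 < η → η ≤ 1 →
    ∃ G : Finset (Vec m × Vec d), (G.card : ℝ) ≤ c * (η ^ (m + d))⁻¹ ∧
      ∀ z : Vec m × Vec d, ‖z‖ ≤ ρ → ∃ g ∈ G, dist z g ≤ η := by
  obtain ⟨c₁, hc₁, h₁⟩ := exists_net m ρ
  obtain ⟨c₂, hc₂, h₂⟩ := exists_net d ρ
  refine ⟨c₁ * c₂, by positivity, fun η hη hη1 => ?_⟩
  obtain ⟨G₁, hG₁, hn₁⟩ := h₁ η hη hη1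
  obtain ⟨G₂, hG₂, hn₂⟩ := h₂ η hη hη1
  refine ⟨G₁ ×ˢ G₂, ?_, ?_⟩
  · rw [Finset.card_product, Nat.cast_mul]
    calc _ ≤ c₁ * (η ^ m)⁻¹ * (c₂ * (η ^ d)⁻¹) := by gcongr
      _ = _ := by rw [pow_add, mul_inv]; ring
  · intro z hz
    obtain ⟨g₁, hg₁, hd₁⟩ := hn₁ z.1 ((norm_fst_le z).trans hz)
    obtain ⟨g₂, hg₂, hd₂⟩ := hn₂ z.2 ((norm_snd_le z).trans hz)
    exact ⟨(g₁, g₂), Finset.mem_product.2 ⟨hg₁, hg₂⟩, max_le hd₁ hd₂⟩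

/-! ### Means of the kernels under the oracle law -/

/-- The law with density `J`. -/
noncomputable def oracleLaw {m d : ℕ} (J : Vec m × Vec d → ℝ) : Measure (Vec m × Vec d) :=
  (volume : Measure (Vec m × Vec d)).withDensity (fun z => ENNReal.ofReal (J z))

section Means

variable {m d : ℕ} {J : Vec m × Vec d → ℝ} {L R : ℝ}

namespace IsJointOracleDensity

lemma continuous (hJ : IsJointOracleDensity J L R) : Continuous J := by
  have : LipschitzWith (Real.toNNReal L) J := LipschitzWith.of_dist_le_mul fun z w => by
    rw [Real.dist_eq, dist_eq_norm]
    exact (hJ.lipschitz z w).trans (mul_le_mul_of_nonneg_right (Real.le_coe_toNNReal L)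
      (norm_nonneg _))
  exact this.continuous

lemma integrable (hJ : IsJointOracleDensity J L R) : Integrable J := by
  by_contra h
  have := hJ.integral_eq_one
  rw [integral_undef h] at this
  exact zero_ne_one this

lemma integral_oracleLaw (hJ : IsJointOracleDensity J L R) (φ : Vec m × Vec d → ℝ) :
    ∫ z, φ z ∂oracleLaw J = ∫ z, J z * φ z := by
  rw [oracleLaw, integral_withDensity_eq_integral_toReal_smul
    (by have := hJ.continuous.measurable; fun_prop)
    (Filter.Eventually.of_forall fun _ => ENNReal.ofReal_lt_top)]
  refine integral_congr_ae (Filter.Eventually.of_forall fun z => ?_)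
  simp [ENNReal.toReal_ofReal (hJ.nonneg z)]

lemma radius_nonneg (hJ : IsJointOracleDensity J L R) : 0 ≤ R := by
  by_contra hR
  have h0 : J = 0 := funext fun z => hJ.support z (lt_of_lt_of_le (not_le.1 hR) (norm_nonneg z))
  have := hJ.integral_eq_one
  simp [h0] at this

/-- A point of norm `R + 1`, where the density vanishes. -/
lemma exists_norm_eq (hm : 0 < m) (hR : 0 ≤ R) : ∃ z : Vec m × Vec d, ‖z‖ = R + 1 := by
  refine ⟨((R + 1) • EuclideanSpace.single ⟨0, hm⟩ (1 : ℝ), 0), ?_⟩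
  rw [Prod.norm_mk, norm_smul, Real.norm_of_nonneg (by linarith)]
  simp
  linarith

lemma lipschitz_nonneg (hm : 0 < m) (hJ : IsJointOracleDensity J L R) : 0 ≤ L := by
  obtain ⟨z, hz⟩ := exists_norm_eq (d := d) hm hJ.radius_nonneg
  have h := (abs_nonneg _).trans (hJ.lipschitz z 0)
  rw [sub_zero, hz] at h
  exact nonneg_of_mul_nonneg_left h (by linarith [hJ.radius_nonneg])

lemma le_max (hm : 0 < m) (hJ : IsJointOracleDensity J L R) (z : Vec m × Vec d) :
    J z ≤ L * (2 * R + 1) := by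
  have hR := hJ.radius_nonneg
  have hL := hJ.lipschitz_nonneg hm
  rcases le_or_gt ‖z‖ R with h | h
  · obtain ⟨w, hw⟩ := exists_norm_eq (d := d) hm hR
    have h1 := le_of_abs_le (hJ.lipschitz z w)
    rw [hJ.support w (by linarith), sub_zero] at h1
    refine h1.trans (mul_le_mul_of_nonneg_left ?_ hL)
    linarith [norm_sub_le z w]
  · rw [hJ.support z h]; positivity

lemma isProbabilityMeasure (hJ : IsJointOracleDensity J L R) :
    IsProbabilityMeasure (oracleLaw J) := by
  constructor
  rw [oracleLaw, withDensity_apply _ MeasurableSet.univ, setLIntegral_univ,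
    ← ofReal_integral_eq_lintegral_ofReal hJ.integrable (Filter.Eventually.of_forall hJ.nonneg),
    hJ.integral_eq_one, ENNReal.ofReal_one]

end IsJointOracleDensity

/-- The product kernel centred at `z`, as a function of the sample. -/
noncomputable def productKernel (hu hξ : ℝ) (z y : Vec m × Vec d) : ℝ :=
  gaussianKernel hu (z.1 - y.1) * gaussianKernel hξ (z.2 - y.2)

variable {hu hξ q : ℝ}

lemma continuous_productKernel (z : Vec m × Vec d) : Continuous (productKernel hu hξ z) := by
  have h1 : Continuous (gaussianKernel hu : Vec m → ℝ) := continuous_gaussianKernel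
  have h2 : Continuous (gaussianKernel hξ : Vec d → ℝ) := continuous_gaussianKernel
  unfold productKernel
  fun_prop

lemma productKernel_pos (hhu : 0 < hu) (hhξ : 0 < hξ) (z y : Vec m × Vec d) :
    0 < productKernel hu hξ z y :=
  mul_pos (gaussianKernel_pos hhu _) (gaussianKernel_pos hhξ _)

lemma integrable_productKernel (hhu : 0 < hu) (hhξ : 0 < hξ) (z : Vec m × Vec d) :
    Integrable (productKernel hu hξ z) :=
  (integrable_gaussianKernel_sub' hhu z.1).mul_prod (integrable_gaussianKernel_sub' hhξ z.2)

lemma integral_productKernel (hhu : 0 < hu) (hhξ : 0 < hξ) (z : Vec m × Vec d) :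
    ∫ y, productKernel hu hξ z y = 1 := by
  simp only [productKernel]
  rw [Measure.volume_eq_prod, integral_prod_mul (fun v : Vec m => gaussianKernel hu (z.1 - v))
    (fun v : Vec d => gaussianKernel hξ (z.2 - v)), integral_gaussianKernel_sub' hhu,
    integral_gaussianKernel_sub' hhξ, one_mul]

lemma productKernel_le (hq : 0 < q) (hqu : q ≤ hu) (hqξ : q ≤ hξ) (z y : Vec m × Vec d) :
    productKernel hu hξ z y ≤ (q ^ (m + d))⁻¹ := by
  rw [pow_add, mul_inv]
  exact mul_le_mul (gaussianKernel_le hq hqu _) (gaussianKernel_le hq hqξ _)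
    (gaussianKernel_pos (hq.trans_le hqξ) _).le (by positivity)

lemma abs_productKernel_sub_le (hq : 0 < q) (hqu : q ≤ hu) (hqξ : q ≤ hξ)
    (z z' y : Vec m × Vec d) :
    |productKernel hu hξ z y - productKernel hu hξ z' y|
      ≤ 2 * (q ^ (m + d + 1))⁻¹ * dist z z' := by
  have hhu := hq.trans_le hqu
  have hhξ := hq.trans_le hqξ
  have e : productKernel hu hξ z y - productKernel hu hξ z' y
      = (gaussianKernel hu (z.1 - y.1) - gaussianKernel hu (z'.1 - y.1))
          * gaussianKernel hξ (z.2 - y.2)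
        + gaussianKernel hu (z'.1 - y.1)
          * (gaussianKernel hξ (z.2 - y.2) - gaussianKernel hξ (z'.2 - y.2)) := by
    simp only [productKernel]; ring
  have h1 := abs_gaussianKernel_sub_le hq hqu (z.1 - y.1) (z'.1 - y.1)
  have h2 := abs_gaussianKernel_sub_le hq hqξ (z.2 - y.2) (z'.2 - y.2)
  rw [sub_sub_sub_cancel_right, ← dist_eq_norm] at h1 h2
  have h1' : |gaussianKernel hu (z.1 - y.1) - gaussianKernel hu (z'.1 - y.1)|
      ≤ (q ^ (m + 1))⁻¹ * dist z z' :=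
    h1.trans (mul_le_mul_of_nonneg_left (le_max_left _ _) (by positivity))
  have h2' : |gaussianKernel hξ (z.2 - y.2) - gaussianKernel hξ (z'.2 - y.2)|
      ≤ (q ^ (d + 1))⁻¹ * dist z z' :=
    h2.trans (mul_le_mul_of_nonneg_left (le_max_right _ _) (by positivity))
  rw [e]
  refine (abs_add_le _ _).trans ?_
  rw [abs_mul, abs_mul, abs_of_pos (gaussianKernel_pos hhξ _), abs_of_pos (gaussianKernel_pos hhu _)]
  calc _ ≤ (q ^ (m + 1))⁻¹ * dist z z' * (q ^ d)⁻¹ + (q ^ m)⁻¹ * ((q ^ (d + 1))⁻¹ * dist z z') := by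
        refine add_le_add (mul_le_mul h1' (gaussianKernel_le hq hqξ _)
          (gaussianKernel_pos hhξ _).le (by positivity)) (mul_le_mul (gaussianKernel_le hq hqu _)
          h2' (abs_nonneg _) (by positivity))
    _ = _ := by
        simp only [pow_add, pow_one, mul_inv]; ring

/-- The mean of the product kernel is at most the density plus a bias of the order of the
bandwidths. -/
lemma integral_productKernel_le (hm : 0 < m) (hJ : IsJointOracleDensity J L R) (hhu : 0 < hu)
    (hhξ : 0 < hξ) (z : Vec m × Vec d) :
    ∫ y, productKernel hu hξ z y ∂oracleLaw J ≤ J z + L * (hu * 2 ^ m + hξ * 2 ^ d) := by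
  have hL := hJ.lipschitz_nonneg hm
  rw [hJ.integral_oracleLaw]
  have hpt : ∀ y, J y * productKernel hu hξ z y ≤ J z * productKernel hu hξ z y
      + L * ((hu * 2 ^ m) * productKernel (2 * hu) hξ z y
        + (hξ * 2 ^ d) * productKernel hu (2 * hξ) z y) := by
    intro y
    have h1 : J y ≤ J z + L * (‖z.1 - y.1‖ + ‖z.2 - y.2‖) := by
      have h := neg_le_of_abs_le (hJ.lipschitz z y)
      have h' : ‖z - y‖ ≤ ‖z.1 - y.1‖ + ‖z.2 - y.2‖ :=
        max_le (le_add_of_nonneg_right (norm_nonneg _)) (le_add_of_nonneg_left (norm_nonneg _))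
      linarith [mul_le_mul_of_nonneg_left h' hL]
    have hp := (productKernel_pos hhu hhξ z y).le
    have h2 : ‖z.1 - y.1‖ * productKernel hu hξ z y
        ≤ (hu * 2 ^ m) * productKernel (2 * hu) hξ z y := by
      simp only [productKernel, ← mul_assoc]
      exact mul_le_mul_of_nonneg_right (norm_mul_gaussianKernel_le hhu _)
        (gaussianKernel_pos hhξ _).le
    have h3 : ‖z.2 - y.2‖ * productKernel hu hξ z y
        ≤ (hξ * 2 ^ d) * productKernel hu (2 * hξ) z y := by
      simp only [productKernel]
      calc _ = gaussianKernel hu (z.1 - y.1) * (‖z.2 - y.2‖ * gaussianKernel hξ (z.2 - y.2)) := by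
            ring
        _ ≤ gaussianKernel hu (z.1 - y.1)
            * (hξ * 2 ^ d * gaussianKernel (2 * hξ) (z.2 - y.2)) :=
          mul_le_mul_of_nonneg_left (norm_mul_gaussianKernel_le hhξ _)
            (gaussianKernel_pos hhu _).le
        _ = _ := by ring
    have h4 := mul_le_mul_of_nonneg_right h1 hp
    have h5 := mul_le_mul_of_nonneg_left (add_le_add h2 h3) hL
    linarith
  have hi1 := integrable_productKernel hhu hhξ z
  have hi2 := integrable_productKernel (by positivity : 0 < 2 * hu) hhξ z
  have hi3 := integrable_productKernel hhu (by positivity : 0 < 2 * hξ) z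
  have hi4 : Integrable (fun y => (hu * 2 ^ m) * productKernel (2 * hu) hξ z y
      + (hξ * 2 ^ d) * productKernel hu (2 * hξ) z y) :=
    (hi2.const_mul (hu * 2 ^ m)).add (hi3.const_mul (hξ * 2 ^ d))
  refine (integral_mono_of_nonneg (Filter.Eventually.of_forall fun y => mul_nonneg (hJ.nonneg y)
    (productKernel_pos hhu hhξ z y).le) ((hi1.const_mul (J z)).add (hi4.const_mul L))
    (Filter.Eventually.of_forall hpt)).trans_eq ?_
  simp only [Pi.add_apply]
  rw [integral_add (hi1.const_mul _) (hi4.const_mul L), integral_const_mul, integral_const_mul,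
    integral_add (hi2.const_mul _) (hi3.const_mul _), integral_const_mul, integral_const_mul,
    integral_productKernel hhu hhξ, integral_productKernel (by positivity) hhξ,
    integral_productKernel hhu (by positivity)]
  ring

lemma integral_productKernel_le_max (hm : 0 < m) (hJ : IsJointOracleDensity J L R) (hhu : 0 < hu)
    (hhξ : 0 < hξ) (z : Vec m × Vec d) :
    ∫ y, productKernel hu hξ z y ∂oracleLaw J ≤ L * (2 * R + 1) := by
  rw [hJ.integral_oracleLaw]
  refine (integral_mono_of_nonneg (Filter.Eventually.of_forall fun y => mul_nonneg (hJ.nonneg y)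
    (productKernel_pos hhu hhξ z y).le) ((integrable_productKernel hhu hhξ z).const_mul
      (L * (2 * R + 1))) (Filter.Eventually.of_forall fun y => mul_le_mul_of_nonneg_right
        (hJ.le_max hm y) (productKernel_pos hhu hhξ z y).le)).trans_eq ?_
  rw [integral_const_mul, integral_productKernel hhu hhξ, mul_one]

/-- The volume of the ball that carries the actions. -/
noncomputable def actionVolume (m : ℕ) (R : ℝ) : ℝ :=
  (volume : Measure (Vec m)).real (Metric.closedBall 0 R)

lemma integrable_indicator_mul_kernel (hhξ : 0 < hξ) (ξ : Vec d) :
    Integrable (fun y : Vec m × Vec d => (Metric.closedBall (0 : Vec m) R).indicator 1 y.1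
      * gaussianKernel hξ (ξ - y.2)) :=
  Integrable.mul_prod (f := (Metric.closedBall (0 : Vec m) R).indicator (1 : Vec m → ℝ))
    ((integrable_indicator_iff Metric.isClosed_closedBall.measurableSet).2
      (integrableOn_const (C := (1 : ℝ)) Metric.isBounded_closedBall.measure_lt_top.ne))
    (integrable_gaussianKernel_sub' hhξ ξ)

lemma integral_indicator_mul_kernel (hhξ : 0 < hξ) (ξ : Vec d) :
    ∫ y : Vec m × Vec d, (Metric.closedBall (0 : Vec m) R).indicator 1 y.1
      * gaussianKernel hξ (ξ - y.2) = actionVolume m R := by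
  rw [Measure.volume_eq_prod,
    integral_prod_mul ((Metric.closedBall (0 : Vec m) R).indicator (1 : Vec m → ℝ))
    (fun v : Vec d => gaussianKernel hξ (ξ - v)), integral_gaussianKernel_sub' hhξ,
    integral_indicator_one Metric.isClosed_closedBall.measurableSet, mul_one, actionVolume]

lemma joint_eq_indicator_mul (hJ : IsJointOracleDensity J L R) (y : Vec m × Vec d) :
    J y = (Metric.closedBall (0 : Vec m) R).indicator 1 y.1 * J y := by
  by_cases h : y.1 ∈ Metric.closedBall (0 : Vec m) R
  · simp [h]
  · rw [Set.indicator_of_notMem h, zero_mul]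
    rw [mem_closedBall_zero_iff, not_le] at h
    exact hJ.support y (h.trans_le (norm_fst_le y))

lemma integral_contextKernel_le_max (hm : 0 < m) (hJ : IsJointOracleDensity J L R)
    (hhξ : 0 < hξ) (ξ : Vec d) :
    ∫ y, gaussianKernel hξ (ξ - y.2) ∂oracleLaw J ≤ L * (2 * R + 1) * actionVolume m R := by
  rw [hJ.integral_oracleLaw]
  refine (integral_mono_of_nonneg (Filter.Eventually.of_forall fun y => mul_nonneg (hJ.nonneg y)
    (gaussianKernel_pos hhξ _).le) ((integrable_indicator_mul_kernel (R := R) hhξ ξ).const_mul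
      (L * (2 * R + 1))) (Filter.Eventually.of_forall fun y => ?_)).trans_eq ?_
  · beta_reduce
    have h0 : (0 : ℝ) ≤ (Metric.closedBall (0 : Vec m) R).indicator 1 y.1 :=
      Set.indicator_nonneg (fun _ _ => zero_le_one) _
    rw [joint_eq_indicator_mul hJ y]
    have := mul_le_mul_of_nonneg_left (hJ.le_max hm y) (mul_nonneg h0
      (gaussianKernel_pos hhξ (ξ - y.2)).le)
    linarith
  · rw [integral_const_mul, integral_indicator_mul_kernel hhξ]

/-- The mean of the context kernel is at least the context density minus a bias of the order of the
bandwidth. -/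
lemma contextDensity_sub_le_integral (hm : 0 < m) (hJ : IsJointOracleDensity J L R)
    (hhξ : 0 < hξ) (ξ : Vec d) :
    contextDensity J ξ - L * actionVolume m R * (hξ * 2 ^ d)
      ≤ ∫ y, gaussianKernel hξ (ξ - y.2) ∂oracleLaw J := by
  have hL := hJ.lipschitz_nonneg hm
  have hJi : Integrable (fun v : Vec m => J (v, ξ)) := by
    refine Continuous.integrable_of_hasCompactSupport
      (hJ.continuous.comp (by fun_prop)) ?_
    refine HasCompactSupport.of_support_subset_isCompact
      (isCompact_closedBall (0 : Vec m) R) fun v hv => ?_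
    by_contra h
    rw [mem_closedBall_zero_iff, not_le] at h
    exact hv (hJ.support _ (h.trans_le (norm_fst_le (v, ξ))))
  have hi1 : Integrable (fun y : Vec m × Vec d => J (y.1, ξ) * gaussianKernel hξ (ξ - y.2)) :=
    hJi.mul_prod (integrable_gaussianKernel_sub' hhξ ξ)
  have hi2 := integrable_indicator_mul_kernel (m := m) (R := R) (by positivity : 0 < 2 * hξ) ξ
  have hI1 : ∫ y : Vec m × Vec d, J (y.1, ξ) * gaussianKernel hξ (ξ - y.2)
      = contextDensity J ξ := by
    rw [Measure.volume_eq_prod, integral_prod_mul (fun v : Vec m => J (v, ξ))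
      (fun v : Vec d => gaussianKernel hξ (ξ - v)), integral_gaussianKernel_sub' hhξ, mul_one,
      contextDensity]
  have hi3 : Integrable (fun y : Vec m × Vec d => J y * gaussianKernel hξ (ξ - y.2)) := by
    refine hJ.integrable.mul_bdd (c := (hξ ^ d)⁻¹) ?_ (Filter.Eventually.of_forall fun y => ?_)
    · have h2 : Continuous (gaussianKernel hξ : Vec d → ℝ) := continuous_gaussianKernel
      exact Continuous.aestronglyMeasurable (by fun_prop)
    · rw [Real.norm_of_nonneg (gaussianKernel_pos hhξ _).le]
      exact gaussianKernel_le hhξ le_rfl _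
  rw [hJ.integral_oracleLaw, ← hI1, ← integral_indicator_mul_kernel (by positivity : 0 < 2 * hξ) ξ]
  have e : L * (∫ y : Vec m × Vec d, (Metric.closedBall (0 : Vec m) R).indicator 1 y.1
      * gaussianKernel (2 * hξ) (ξ - y.2)) * (hξ * 2 ^ d)
      = ∫ y : Vec m × Vec d, L * (hξ * 2 ^ d) * ((Metric.closedBall (0 : Vec m) R).indicator 1 y.1
      * gaussianKernel (2 * hξ) (ξ - y.2)) := by
    rw [integral_const_mul]; ring
  rw [e, ← integral_sub hi1 (hi2.const_mul _)]
  refine integral_mono (hi1.sub (hi2.const_mul _)) hi3 fun y => ?_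
  beta_reduce
  by_cases h : y.1 ∈ Metric.closedBall (0 : Vec m) R
  · have h1 := le_of_abs_le (hJ.lipschitz (y.1, ξ) y)
    have h2 : ‖(y.1, ξ) - y‖ = ‖ξ - y.2‖ := by
      have : (y.1, ξ) - y = ((0 : Vec m), ξ - y.2) := by ext <;> simp
      rw [this, Prod.norm_mk, norm_zero]
      exact max_eq_right (norm_nonneg _)
    rw [h2] at h1
    have h3 := mul_le_mul_of_nonneg_right h1 (gaussianKernel_pos hhξ (ξ - y.2)).le
    have h4 := mul_le_mul_of_nonneg_left (norm_mul_gaussianKernel_le hhξ (ξ - y.2)) hL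
    simp only [Set.indicator_of_mem h, Pi.one_apply, one_mul]
    linarith
  · have h' := h
    rw [mem_closedBall_zero_iff, not_le] at h'
    rw [Set.indicator_of_notMem h, hJ.support (y.1, ξ) (h'.trans_le (norm_fst_le (y.1, ξ))),
      hJ.support y (h'.trans_le (norm_fst_le y))]
    simp

end Means

/-! ### The rate -/

/-- The rate `N ^ (-1 / (k + 4))`, the order of the bandwidths. -/
noncomputable def rate (k N : ℕ) : ℝ := (N : ℝ) ^ (-(1 : ℝ) / ((k : ℝ) + 4))

lemma rate_pos (k : ℕ) {N : ℕ} (hN : 1 ≤ N) : 0 < rate k N :=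
  Real.rpow_pos_of_pos (by exact_mod_cast hN) _

lemma rate_le_one (k : ℕ) {N : ℕ} (hN : 1 ≤ N) : rate k N ≤ 1 :=
  Real.rpow_le_one_of_one_le_of_nonpos (by exact_mod_cast hN)
    (div_nonpos_of_nonpos_of_nonneg (by norm_num) (by positivity))

lemma mul_rate_pow (k : ℕ) {N : ℕ} (hN : 1 ≤ N) : (N : ℝ) * rate k N ^ (k + 4) = 1 := by
  have hN' : (0 : ℝ) < N := by exact_mod_cast hN
  rw [rate, ← Real.rpow_natCast _ (k + 4), ← Real.rpow_mul hN'.le]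
  have : -(1 : ℝ) / ((k : ℝ) + 4) * ((k + 4 : ℕ) : ℝ) = -1 := by
    push_cast
    field_simp
  rw [this, Real.rpow_neg_one, mul_inv_cancel₀ hN'.ne']

lemma sqrt_mul_rate_le {k N : ℕ} {C₀ C : ℝ} (hN : 1 ≤ N) (hC : C₀ ≤ C) :
    Real.sqrt C₀ * rate k N ≤ Real.sqrt (errorRate k C N) := by
  have hN' : (0 : ℝ) < N := by exact_mod_cast hN
  have h1 : Real.sqrt ((N : ℝ) ^ ((2 : ℝ) / ((k : ℝ) + 4))) = (rate k N)⁻¹ := by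
    rw [Real.sqrt_eq_rpow, ← Real.rpow_mul hN'.le, rate, ← Real.rpow_neg hN'.le]
    congr 1
    ring
  rw [errorRate, Real.sqrt_div' _ (Real.rpow_nonneg hN'.le _), h1, div_inv_eq_mul]
  exact mul_le_mul_of_nonneg_right (Real.sqrt_le_sqrt hC) (rate_pos k hN).le

/-- A sub-Gaussian tail in `1 / w`, at the rate `w = N ^ (-1 / (k + 4))`, absorbs any polynomial
factor and leaves a summable bound with a constant as small as desired. -/
lemma exists_exponent (k j : ℕ) {c κ δ : ℝ} (hc : 0 < c) (hκ : 0 < κ) (hδ : 0 < δ) :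
    ∃ Q : ℝ, 0 < Q ∧ ∀ N : ℕ, 1 ≤ N →
      c * (rate k N ^ j)⁻¹ * Real.exp (-(Q * (κ * (rate k N ^ 2)⁻¹))) ≤ δ * (1 / (N : ℝ) ^ 2) := by
  set l : ℕ := j + (k + 4) with hl
  set P : ℝ := 1 + c * (l.factorial : ℝ) / δ with hP
  have hP1 : 1 ≤ P := by
    have : 0 ≤ c * (l.factorial : ℝ) / δ := by positivity
    linarith
  refine ⟨P / κ, by positivity, fun N hN => ?_⟩
  have hN' : (0 : ℝ) < N := by exact_mod_cast hN
  have hw0 := rate_pos k hN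
  have hw1 := rate_le_one k hN
  have hwN := mul_rate_pow k hN
  set w := rate k N with hw
  have e1 : P / κ * (κ * (w ^ 2)⁻¹) = P * (w ^ 2)⁻¹ := by field_simp
  have hx : 0 < P * (w ^ 2)⁻¹ := by positivity
  have hexp : Real.exp (-(P * (w ^ 2)⁻¹)) ≤ l.factorial / (P * (w ^ 2)⁻¹) ^ l := by
    rw [Real.exp_neg, ← inv_div]
    exact inv_anti₀ (by positivity) (Real.pow_div_factorial_le_exp _ hx.le l)
  have hPl : P ≤ P ^ l := le_self_pow₀ hP1 (by omega)
  have hcP : c * (l.factorial : ℝ) ≤ δ * P ^ l := by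
    have : c * (l.factorial : ℝ) ≤ δ * P := by
      rw [hP, mul_add, mul_div_cancel₀ _ hδ.ne']
      linarith
    exact this.trans (mul_le_mul_of_nonneg_left hPl hδ.le)
  have hN2 : 1 / (N : ℝ) ^ 2 = w ^ (2 * (k + 4)) := by
    rw [eq_comm, eq_div_iff (by positivity), mul_comm 2, pow_mul, ← mul_pow, mul_comm, hwN, one_pow]
  rw [e1, hN2]
  calc c * (w ^ j)⁻¹ * Real.exp (-(P * (w ^ 2)⁻¹))
      ≤ c * (w ^ j)⁻¹ * (l.factorial / (P * (w ^ 2)⁻¹) ^ l) := by gcongr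
    _ = c * l.factorial / P ^ l * w ^ (j + 2 * (k + 4)) := by
        have : w ^ (2 * l) = w ^ (j + 2 * (k + 4)) * w ^ j := by rw [← pow_add]; congr 1; omega
        rw [mul_pow, inv_pow, ← pow_mul]
        field_simp
        linear_combination (c * (l.factorial : ℝ)) * this
    _ ≤ δ * w ^ (j + 2 * (k + 4)) := by
        gcongr
        rw [div_le_iff₀ (by positivity)]
        exact hcP
    _ ≤ δ * w ^ (2 * (k + 4)) := by
        gcongr 1
        exact pow_le_pow_of_le_one hw0.le hw1 (by omega)

/-! ### Uniform deviations of the kernel density estimates -/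

lemma integral_sq_le {E : Type*} [MeasurableSpace E] {ν : Measure E} [IsFiniteMeasure ν]
    {φ : E → ℝ} (hφ : Measurable φ) {B V : ℝ} (hB0 : 0 ≤ B) (h0 : ∀ y, 0 ≤ φ y)
    (hB : ∀ y, φ y ≤ B) (hV : ∫ y, φ y ∂ν ≤ V) : ∫ y, φ y ^ 2 ∂ν ≤ B * V := by
  have hi : Integrable φ ν := Integrable.of_bound hφ.aestronglyMeasurable B
    (Filter.Eventually.of_forall fun y => by rw [Real.norm_of_nonneg (h0 y)]; exact hB y)
  calc ∫ y, φ y ^ 2 ∂ν ≤ ∫ y, B * φ y ∂ν :=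
        integral_mono_of_nonneg (Filter.Eventually.of_forall fun y => sq_nonneg _)
          (hi.const_mul B) (Filter.Eventually.of_forall fun y => by
            beta_reduce
            rw [sq]; exact mul_le_mul_of_nonneg_right (hB y) (h0 y))
    _ = B * ∫ y, φ y ∂ν := integral_const_mul _ _
    _ ≤ B * V := mul_le_mul_of_nonneg_left hV hB0

/-- The constant that bounds the means of both kernels. -/
noncomputable def meanBound (m : ℕ) (L R : ℝ) : ℝ :=
  |L| * (2 * |R| + 1) * (1 + actionVolume m R)

/-- The empirical context density from the first `N` samples. -/
noncomputable def contextKDE {m d : ℕ} (s : ℕ → Vec m × Vec d) (N : ℕ) (hξ : ℝ) (ξ : Vec d) : ℝ :=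
  (1 / (N : ℝ)) * ∑ i ∈ Finset.range N, gaussianKernel hξ (ξ - (s i).2)

section Events

variable {m d : ℕ} {Ω : Type*} [MeasurableSpace Ω] {μ : Measure Ω}
  {J : Vec m × Vec d → ℝ} {L R : ℝ} {s : ℕ → Ω → Vec m × Vec d}

lemma measure_norm_gt_eq_zero (hJ : IsJointOracleDensity J L R) (hs : IsSampleStream μ s J) :
    μ {ω | ∃ i, R < ‖s i ω‖} = 0 := by
  have e : {ω | ∃ i, R < ‖s i ω‖} = ⋃ i, s i ⁻¹' {z | R < ‖z‖} := by ext ω; simp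
  have hmeas : MeasurableSet {z : Vec m × Vec d | R < ‖z‖} :=
    (isOpen_lt continuous_const continuous_norm).measurableSet
  rw [e, measure_iUnion_null_iff]
  intro i
  rw [← Measure.map_apply (hs.measurable i) hmeas, hs.law i, withDensity_apply _ hmeas]
  rw [setLIntegral_congr_fun hmeas (g := fun _ => 0) fun z hz => by
    simp [hJ.support z hz]]
  simp

lemma measurableSet_norm_gt (hs : IsSampleStream μ s J) :
    MeasurableSet {ω | ∃ i, R < ‖s i ω‖} := by
  have e : {ω | ∃ i, R < ‖s i ω‖} = ⋃ i, {ω | R < ‖s i ω‖} := by ext ω; simp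
  rw [e]
  exact MeasurableSet.iUnion fun i => measurableSet_lt measurable_const (hs.measurable i).norm

/-- Joint deviations for one sample size `N`: with bandwidths in `[q, H]`, the joint estimate exceeds
the density by at most the deviation `A w`, the discretization error `4 q` and the bias. -/
lemma exists_joint_deviation_event [IsProbabilityMeasure μ] (hm : 0 < m)
    (hJ : IsJointOracleDensity J L R) (hs : IsSampleStream μ s J) {hu hξ q w A H : ℝ} (hq : 0 < q)
    (hqu : q ≤ hu) (hqξ : q ≤ hξ) (huH : hu ≤ H) (hξH : hξ ≤ H) (hw0 : 0 ≤ w) (hw1 : w ≤ 1) {N : ℕ}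
    (hN : 1 ≤ N) {G : Finset (Vec m × Vec d)}
    (hG : ∀ z : Vec m × Vec d, ‖z‖ ≤ R + 1 → ∃ g ∈ G, dist z g ≤ q ^ (m + d + 2)) :
    ∃ D : Set Ω, MeasurableSet D ∧
      μ D ≤ ENNReal.ofReal (G.card *
        Real.exp (-((A - meanBound m L R) * (N * w ^ 2 * q ^ (m + d))))) ∧
      ∀ ω ∉ D, ∀ z : Vec m × Vec d, ‖z‖ ≤ R + 1 →
        jointKDE (fun i => s i ω) N hu hξ z.1 z.2
            ≤ J z + A * w + 4 * q + |L| * H * (2 ^ m + 2 ^ d) := by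
  have hhu := hq.trans_le hqu
  have hhξ := hq.trans_le hqξ
  have hR := hJ.radius_nonneg
  have hL := hJ.lipschitz_nonneg hm
  have hvol : 0 ≤ actionVolume m R := measureReal_nonneg
  have := hJ.isProbabilityMeasure
  have hlaw : ∀ i, μ.map (s i) = oracleLaw J := hs.law
  have hLM : 0 ≤ L * (2 * R + 1) := by positivity
  have hM1 : L * (2 * R + 1) ≤ meanBound m L R := by
    rw [meanBound, abs_of_nonneg hL, abs_of_nonneg hR]
    nlinarith
  have hB0 : 0 < (q ^ (m + d))⁻¹ := by positivity
  have hΛ0 : 0 ≤ 2 * (q ^ (m + d + 1))⁻¹ := by positivity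
  have hdisc : 2 * (2 * (q ^ (m + d + 1))⁻¹) * q ^ (m + d + 2) = 4 * q := by
    rw [show m + d + 2 = m + d + 1 + 1 by ring, pow_succ q (m + d + 1)]
    field_simp
    norm_num
  have hbd : ∀ z y : Vec m × Vec d, |productKernel hu hξ z y| ≤ (q ^ (m + d))⁻¹ := fun z y => by
    rw [abs_of_pos (productKernel_pos hhu hhξ z y)]
    exact productKernel_le hq hqu hqξ z y
  have hsq : ∀ z : Vec m × Vec d, ∫ y, productKernel hu hξ z y ^ 2 ∂oracleLaw J
      ≤ (q ^ (m + d))⁻¹ * meanBound m L R := fun z =>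
    integral_sq_le (continuous_productKernel z).measurable hB0.le
      (fun y => (productKernel_pos hhu hhξ z y).le) (productKernel_le hq hqu hqξ z)
      ((integral_productKernel_le_max hm hJ hhu hhξ z).trans hM1)
  obtain ⟨D, hDm, hD, h₁⟩ := exists_uniform_deviation_event (A := A) (η := q ^ (m + d + 2))
    hs.measurable hs.indep hlaw (fun z => (continuous_productKernel z).measurable) hB0 hbd
    hw0 hw1 hsq hΛ0 (abs_productKernel_sub_le hq hqu hqξ) hN G
  rw [div_inv_eq_mul] at hD
  refine ⟨D, hDm, hD, fun ω hω z hz => ?_⟩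
  have h := h₁ ω hω z (hG z hz)
  have hb := integral_productKernel_le hm hJ hhu hhξ z
  have hbias : L * (hu * 2 ^ m + hξ * 2 ^ d) ≤ |L| * H * (2 ^ m + 2 ^ d) := by
    have h1 : hu * 2 ^ m ≤ H * 2 ^ m := by gcongr
    have h2 : hξ * 2 ^ d ≤ H * 2 ^ d := by gcongr
    rw [abs_of_nonneg hL]
    linarith [mul_le_mul_of_nonneg_left (add_le_add h1 h2) hL]
  have e : jointKDE (fun i => s i ω) N hu hξ z.1 z.2
      = (1 / (N : ℝ)) * ∑ i ∈ Finset.range N, productKernel hu hξ z (s i ω) := rfl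
  rw [hdisc, ← e] at h
  linarith

/-- Context deviations for one sample size: the empirical context density falls below the context
density by at most the deviation, the discretization error and the bias. -/
lemma exists_context_deviation_event [IsProbabilityMeasure μ] (hm : 0 < m)
    (hJ : IsJointOracleDensity J L R) (hs : IsSampleStream μ s J) {hξ q w A H : ℝ} (hq : 0 < q)
    (hq1 : q ≤ 1) (hqξ : q ≤ hξ) (hξH : hξ ≤ H) (hw0 : 0 ≤ w) (hw1 : w ≤ 1) {N : ℕ}
    (hN : 1 ≤ N) {G : Finset (Vec m × Vec d)}
    (hG : ∀ z : Vec m × Vec d, ‖z‖ ≤ R + 1 → ∃ g ∈ G, dist z g ≤ q ^ (m + d + 2)) :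
    ∃ D : Set Ω, MeasurableSet D ∧
      μ D ≤ ENNReal.ofReal (G.card *
        Real.exp (-((A - meanBound m L R) * (N * w ^ 2 * q ^ (m + d))))) ∧
      ∀ ω ∉ D, ∀ z : Vec m × Vec d, ‖z‖ ≤ R + 1 →
        contextDensity J z.2 - A * w - 4 * q - |L| * actionVolume m R * H * 2 ^ d
            ≤ contextKDE (fun i => s i ω) N hξ z.2 := by
  have hhξ := hq.trans_le hqξ
  have hR := hJ.radius_nonneg
  have hL := hJ.lipschitz_nonneg hm
  have hvol : 0 ≤ actionVolume m R := measureReal_nonneg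
  have := hJ.isProbabilityMeasure
  have hlaw : ∀ i, μ.map (s i) = oracleLaw J := hs.law
  have hLM : 0 ≤ L * (2 * R + 1) := by positivity
  have hM2 : L * (2 * R + 1) * actionVolume m R ≤ meanBound m L R := by
    rw [meanBound, abs_of_nonneg hL, abs_of_nonneg hR]
    nlinarith
  have hB0 : 0 < (q ^ (m + d))⁻¹ := by positivity
  have hΛ0 : 0 ≤ 2 * (q ^ (m + d + 1))⁻¹ := by positivity
  have hdisc : 2 * (2 * (q ^ (m + d + 1))⁻¹) * q ^ (m + d + 2) = 4 * q := by
    rw [show m + d + 2 = m + d + 1 + 1 by ring, pow_succ q (m + d + 1)]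
    field_simp
    norm_num
  have hcb : ∀ z y : Vec m × Vec d, gaussianKernel hξ (z.2 - y.2) ≤ (q ^ (m + d))⁻¹ := fun z y =>
    (gaussianKernel_le hq hqξ _).trans (inv_anti₀ (by positivity)
      (pow_le_pow_of_le_one hq.le hq1 (by omega)))
  have hmeas : ∀ z : Vec m × Vec d,
      Measurable (fun y : Vec m × Vec d => gaussianKernel hξ (z.2 - y.2)) := fun z =>
    ((continuous_gaussianKernel (h := hξ) (k := d)).comp (by fun_prop)).measurable
  have hmeas' : ∀ z : Vec m × Vec d,
      Measurable (fun y : Vec m × Vec d => -gaussianKernel hξ (z.2 - y.2)) := fun z =>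
    (hmeas z).neg
  have hbd : ∀ z y : Vec m × Vec d, |-gaussianKernel hξ (z.2 - y.2)| ≤ (q ^ (m + d))⁻¹ :=
    fun z y => by
      rw [abs_neg, abs_of_pos (gaussianKernel_pos hhξ _)]; exact hcb z y
  have hsq : ∀ z : Vec m × Vec d, ∫ y, (-gaussianKernel hξ (z.2 - y.2)) ^ 2 ∂oracleLaw J
      ≤ (q ^ (m + d))⁻¹ * meanBound m L R := fun z => by
    simp only [neg_sq]
    exact integral_sq_le (hmeas z) hB0.le (fun y => (gaussianKernel_pos hhξ _).le) (hcb z)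
      ((integral_contextKernel_le_max hm hJ hhξ z.2).trans hM2)
  have hlip : ∀ z z' y : Vec m × Vec d,
      |-gaussianKernel hξ (z.2 - y.2) - -gaussianKernel hξ (z'.2 - y.2)|
        ≤ 2 * (q ^ (m + d + 1))⁻¹ * dist z z' := fun z z' y => by
    rw [neg_sub_neg, abs_sub_comm]
    refine (abs_gaussianKernel_sub_le hq hqξ _ _).trans ?_
    rw [sub_sub_sub_cancel_right, ← dist_eq_norm]
    refine mul_le_mul ?_ (le_max_right _ _) dist_nonneg hΛ0
    have : (q ^ (d + 1))⁻¹ ≤ (q ^ (m + d + 1))⁻¹ :=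
      inv_anti₀ (by positivity) (pow_le_pow_of_le_one hq.le hq1 (by omega))
    have h0 : 0 ≤ (q ^ (m + d + 1))⁻¹ := by positivity
    linarith
  obtain ⟨D, hDm, hD, h₂⟩ := exists_uniform_deviation_event (A := A) (η := q ^ (m + d + 2))
    hs.measurable hs.indep hlaw hmeas' hB0 hbd hw0 hw1 hsq hΛ0 hlip hN G
  rw [div_inv_eq_mul] at hD
  refine ⟨D, hDm, hD, fun ω hω z hz => ?_⟩
  have h := h₂ ω hω z (hG z hz)
  have hb := contextDensity_sub_le_integral hm hJ hhξ z.2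
  have hbias : L * actionVolume m R * (hξ * 2 ^ d) ≤ |L| * actionVolume m R * H * 2 ^ d := by
    rw [abs_of_nonneg hL, ← mul_assoc]
    gcongr
  have e : (1 / (N : ℝ)) * ∑ i ∈ Finset.range N, -gaussianKernel hξ (z.2 - (s i ω).2)
      = -contextKDE (fun i => s i ω) N hξ z.2 := by
    rw [contextKDE, Finset.sum_neg_distrib, mul_neg]
  rw [hdisc, e, integral_neg] at h
  linarith

end Events

/-- The estimates are uniformly within the rate of their limits, on the safe side, simultaneously
for all sample sizes and outside an event of small probability. -/
lemma exists_deviation_event (m d : ℕ) (hm : 0 < m) (L R : ℝ) {a b δ : ℝ} (ha : 0 < a)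
    (hab : a ≤ b) (hδ : 0 < δ) :
    ∃ A : ℝ, 0 < A ∧ ∀ {Ω : Type*} [MeasurableSpace Ω] (μ : Measure Ω) [IsProbabilityMeasure μ]
      (J : Vec m × Vec d → ℝ) (s : ℕ → Ω → Vec m × Vec d) (hu hξ : ℕ → ℝ),
      IsJointOracleDensity J L R → IsSampleStream μ s J →
      IsBandwidth (m + d) a b hu → IsBandwidth (m + d) a b hξ →
      ∃ D : Set Ω, MeasurableSet D ∧ μ D ≤ ENNReal.ofReal δ ∧
        ∀ ω ∉ D, (∀ i, ‖s i ω‖ ≤ R) ∧ ∀ N, 1 ≤ N → ∀ z : Vec m × Vec d, ‖z‖ ≤ R + 1 →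
          jointKDE (fun i => s i ω) N (hu N) (hξ N) z.1 z.2 ≤ J z + A * rate (m + d) N ∧
          contextDensity J z.2 - A * rate (m + d) N
            ≤ contextKDE (fun i => s i ω) N (hξ N) z.2 := by
  obtain ⟨c, hc, hnet⟩ := exists_net_prod m d (R + 1)
  set a' := min a 1 with ha'
  have ha'0 : 0 < a' := lt_min ha one_pos
  have hsummable : Summable (fun n : ℕ => 1 / ((n + 1 : ℕ) : ℝ) ^ 2) :=
    (summable_nat_add_iff 1).2 (Real.summable_one_div_nat_pow.2 one_lt_two)
  set Z := ∑' n : ℕ, 1 / ((n + 1 : ℕ) : ℝ) ^ 2 with hZ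
  have hZ0 : 0 < Z := hsummable.tsum_pos (fun n => by positivity) 0 (by positivity)
  set j := (m + d + 2) * (m + d) with hj
  obtain ⟨Q, hQ, hQN⟩ := exists_exponent (m + d) j (c := 2 * (c * (a' ^ j)⁻¹))
    (κ := a' ^ (m + d)) (δ := δ / Z) (by positivity) (by positivity) (by positivity)
  have hvol : 0 ≤ actionVolume m R := measureReal_nonneg
  have hM : 0 ≤ meanBound m L R := by unfold meanBound; positivity
  have hb : 0 < b := ha.trans_le hab
  set A₀ := Q + meanBound m L R with hA₀
  have hA₀0 : 0 < A₀ := by positivity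
  refine ⟨A₀ + 4 + |L| * b * (2 ^ m + 2 ^ d) + |L| * actionVolume m R * b * 2 ^ d,
    by positivity, ?_⟩
  intro Ω _ μ _ J s hu hξ hJ hs hhu hhξ
  have hD : ∀ n : ℕ, ∃ D : Set Ω, MeasurableSet D ∧
      μ D ≤ ENNReal.ofReal (δ / Z * (1 / ((n + 1 : ℕ) : ℝ) ^ 2)) ∧
      ∀ ω ∉ D, ∀ z : Vec m × Vec d, ‖z‖ ≤ R + 1 →
        jointKDE (fun i => s i ω) (n + 1) (hu (n + 1)) (hξ (n + 1)) z.1 z.2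
          ≤ J z + (A₀ + 4 + |L| * b * (2 ^ m + 2 ^ d) + |L| * actionVolume m R * b * 2 ^ d)
            * rate (m + d) (n + 1) ∧
        contextDensity J z.2 - (A₀ + 4 + |L| * b * (2 ^ m + 2 ^ d)
            + |L| * actionVolume m R * b * 2 ^ d) * rate (m + d) (n + 1)
          ≤ contextKDE (fun i => s i ω) (n + 1) (hξ (n + 1)) z.2 := by
    intro n
    have hN : 1 ≤ n + 1 := Nat.le_add_left 1 n
    have hw0 := rate_pos (m + d) hN
    have hw1 := rate_le_one (m + d) hN
    have hwN := mul_rate_pow (m + d) hN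
    have hQn := hQN (n + 1) hN
    have hbu := hhu (n + 1) hN
    have hbξ := hhξ (n + 1) hN
    change a * rate (m + d) (n + 1) ≤ _ ∧ _ ≤ b * rate (m + d) (n + 1) at hbu hbξ
    set w := rate (m + d) (n + 1) with hw
    set q := a' * w with hqdef
    have hq0 : 0 < q := by positivity
    have hqw : q ≤ w := mul_le_of_le_one_left hw0.le (min_le_right _ _)
    have hqa : q ≤ a * w := mul_le_mul_of_nonneg_right (min_le_left _ _) hw0.le
    -- this mesh turns the Lipschitz constant `2 / q ^ (m + d + 1)` into an error of order `q`
    obtain ⟨G, hGc, hG⟩ := hnet (q ^ (m + d + 2)) (by positivity)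
      (pow_le_one₀ hq0.le (hqw.trans hw1))
    obtain ⟨D₁, hD₁m, hD₁μ, hD₁ω⟩ := exists_joint_deviation_event (A := A₀) hm hJ hs hq0
      (hqa.trans hbu.1) (hqa.trans hbξ.1) hbu.2 hbξ.2 hw0.le hw1 hN hG
    obtain ⟨D₂, hD₂m, hD₂μ, hD₂ω⟩ := exists_context_deviation_event (A := A₀) hm hJ hs hq0
      (hqw.trans hw1) (hqa.trans hbξ.1) hbξ.2 hw0.le hw1 hN hG
    refine ⟨D₁ ∪ D₂, hD₁m.union hD₂m, ?_, fun ω hω z hz => ?_⟩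
    · refine (measure_union_le _ _).trans ((add_le_add hD₁μ hD₂μ).trans ?_)
      rw [← ENNReal.ofReal_add (by positivity) (by positivity), ← two_mul]
      refine ENNReal.ofReal_le_ofReal (le_trans ?_ hQn)
      have e1 : A₀ - meanBound m L R = Q := by rw [hA₀]; ring
      have e2 : ((n + 1 : ℕ) : ℝ) * w ^ 2 * q ^ (m + d) = a' ^ (m + d) * (w ^ 2)⁻¹ := by
        rw [hqdef, mul_pow]
        rw [show m + d + 4 = (m + d) + 2 + 2 by ring, pow_add, pow_add] at hwN
        field_simp
        linear_combination hwN
      have e3 : ((q ^ (m + d + 2)) ^ (m + d))⁻¹ = (a' ^ j)⁻¹ * (w ^ j)⁻¹ := by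
        rw [← pow_mul, ← hj, hqdef, mul_pow, mul_inv]
      rw [e1, e2]
      rw [e3] at hGc
      calc _ ≤ 2 * (c * ((a' ^ j)⁻¹ * (w ^ j)⁻¹)
            * Real.exp (-(Q * (a' ^ (m + d) * (w ^ 2)⁻¹)))) := by gcongr
        _ = _ := by ring
    · have h1 := hD₁ω ω (fun h => hω (Or.inl h)) z hz
      have h2 := hD₂ω ω (fun h => hω (Or.inr h)) z hz
      have p1 : 0 ≤ |L| * b * (2 ^ m + 2 ^ d) * w := by positivity
      have p2 : 0 ≤ |L| * actionVolume m R * b * 2 ^ d * w := by positivity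
      constructor
      · linarith
      · linarith
  choose D hDm hDμ hDω using hD
  refine ⟨{ω | ∃ i, R < ‖s i ω‖} ∪ ⋃ n, D n,
    (measurableSet_norm_gt hs).union (MeasurableSet.iUnion hDm), ?_, fun ω hω => ⟨fun i => ?_, ?_⟩⟩
  · refine (measure_union_le _ _).trans ?_
    rw [measure_norm_gt_eq_zero hJ hs, zero_add]
    refine (measure_iUnion_le D).trans ((ENNReal.tsum_le_tsum hDμ).trans_eq ?_)
    rw [← ENNReal.ofReal_tsum_of_nonneg (fun n => by positivity) (hsummable.mul_left _),
      tsum_mul_left, ← hZ, div_mul_cancel₀ _ hZ0.ne']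
  · by_contra h
    exact hω (Or.inl ⟨i, not_le.1 h⟩)
  · intro N hN z hz
    obtain ⟨n, rfl⟩ : ∃ n, N = n + 1 := ⟨N - 1, by omega⟩
    exact hDω n ω (fun h => hω (Or.inr (Set.mem_iUnion.2 ⟨n, h⟩))) z hz


/-! ### The learned density off the feasible set -/

/-- Radial projection to a ball does not increase the distance to the points of the ball. -/
lemma norm_smul_sub_le {k : ℕ} {u c : Vec k} {ρ : ℝ} (hρ : 0 ≤ ρ) (hc : ‖c‖ ≤ ρ) (hu : ρ < ‖u‖) :
    ‖(ρ / ‖u‖) • u - c‖ ≤ ‖u - c‖ := by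
  have hu0 : 0 < ‖u‖ := hρ.trans_lt hu
  set θ := ρ / ‖u‖ with hθ
  have hθu : θ * ‖u‖ = ρ := by rw [hθ]; field_simp
  have hθ1 : θ ≤ 1 := (div_le_one hu0).2 hu.le
  refine (pow_le_pow_iff_left₀ (norm_nonneg _) (norm_nonneg _) two_ne_zero).1 ?_
  have h0 : 0 ≤ θ := by positivity
  have hin : ⟪u, c⟫ ≤ ‖u‖ * ρ :=
    (real_inner_le_norm u c).trans (mul_le_mul_of_nonneg_left hc hu0.le)
  rw [norm_sub_sq_real, norm_sub_sq_real, real_inner_smul_left, norm_smul, Real.norm_of_nonneg h0,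
    hθu]
  have h1 := mul_le_mul_of_nonneg_left hin (sub_nonneg.2 hθ1)
  have h2 : (1 - θ) * (‖u‖ * ρ) = ‖u‖ * ρ - ρ * ρ := by rw [sub_mul, ← mul_assoc θ, hθu, one_mul]
  nlinarith [sq_nonneg (‖u‖ - ρ)]

lemma jointKDE_le_of_norm_le {m d : ℕ} {s : ℕ → Vec m × Vec d} {N : ℕ} {hu hξ : ℝ} (hhu : 0 < hu)
    (hhξ : 0 < hξ) {u u' : Vec m} (ξ : Vec d) (h : ∀ i, ‖u' - (s i).1‖ ≤ ‖u - (s i).1‖) :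
    jointKDE s N hu hξ u ξ ≤ jointKDE s N hu hξ u' ξ := by
  unfold jointKDE
  refine mul_le_mul_of_nonneg_left (Finset.sum_le_sum fun i _ => ?_) (by positivity)
  exact mul_le_mul_of_nonneg_right (gaussianKernel_le_of_norm_le hhu (h i))
    (gaussianKernel_pos hhξ _).le

/-- At an infeasible action the joint estimate is of the order of the rate, uniformly: far actions
are dominated by their projections, since the samples lie in the ball of radius `R`. -/
lemma jointKDE_le_of_eq_zero {m d : ℕ} {J : Vec m × Vec d → ℝ} {L R : ℝ}
    (hJ : IsJointOracleDensity J L R) {s : ℕ → Vec m × Vec d} {N : ℕ} {hu hξ e : ℝ} (hhu : 0 < hu)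
    (hhξ : 0 < hξ) (hs : ∀ i, ‖s i‖ ≤ R)
    (hdev : ∀ z : Vec m × Vec d, ‖z‖ ≤ R + 1 → jointKDE s N hu hξ z.1 z.2 ≤ J z + e)
    {u : Vec m} {ξ : Vec d} (hξR : ‖ξ‖ ≤ R) (h0 : J (u, ξ) = 0) :
    jointKDE s N hu hξ u ξ ≤ e := by
  have hR := hJ.radius_nonneg
  rcases le_or_gt ‖u‖ (R + 1) with h | h
  · have := hdev (u, ξ) (max_le h (by linarith))
    rwa [h0, zero_add] at this
  · set u' := ((R + 1) / ‖u‖) • u with hu'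
    have hn : ‖u'‖ = R + 1 := by
      have : ‖u‖ ≠ 0 := by linarith
      rw [hu', norm_smul, Real.norm_of_nonneg (by positivity)]
      field_simp
    have h1 : jointKDE s N hu hξ u ξ ≤ jointKDE s N hu hξ u' ξ :=
      jointKDE_le_of_norm_le hhu hhξ ξ fun i => norm_smul_sub_le (by linarith)
        (((norm_fst_le (s i)).trans (hs i)).trans (by linarith)) h
    have h2 := hdev (u', ξ) (max_le hn.le (by linarith))
    have h3 : R < ‖(u', ξ)‖ := (lt_add_one R).trans_le (hn ▸ norm_fst_le (u', ξ))
    rw [hJ.support _ h3, zero_add] at h2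
    exact h1.trans h2

lemma norm_context_le {m d : ℕ} {J : Vec m × Vec d → ℝ} {L R : ℝ}
    (hJ : IsJointOracleDensity J L R) {ξ : Vec d} (h : 0 < contextDensity J ξ) : ‖ξ‖ ≤ R := by
  by_contra hξ
  have h0 : ∀ v : Vec m, J (v, ξ) = 0 := fun v =>
    hJ.support _ ((not_le.1 hξ).trans_le (norm_snd_le (v, ξ)))
  simp [contextDensity, h0] at h

/-- The high-probability event: the learned conditional density is at most `√C₀` times the rate at
all actions that the oracle excludes, for all sample sizes and all contexts of density at least
`πmin`. If the error of the estimated context density does not exceed `πmin / 2`, the quotient is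
controlled by its numerator; otherwise the rate is bounded below and the height of a single kernel
is a sufficient bound. -/
lemma exists_safe_event (m d T : ℕ) (hm : 0 < m) {δ : ℝ} (hδ : 0 < δ)
    (L R : ℝ) {πmin a b : ℝ} (hπ : 0 < πmin) (ha : 0 < a) (hab : a ≤ b) :
    ∃ C₀ : ℝ, 0 < C₀ ∧ ∀ {Ω : Type*} [MeasurableSpace Ω] (μ : Measure Ω) [IsProbabilityMeasure μ]
      (J : ℕ → Vec m × Vec d → ℝ) (s : ℕ → ℕ → Ω → Vec m × Vec d) (hu hξ : ℕ → ℝ),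
      (∀ t ≤ T, IsJointOracleDensity (J t) L R) → (∀ t ≤ T, IsSampleStream μ (s t) (J t)) →
      IsBandwidth (m + d) a b hu → IsBandwidth (m + d) a b hξ →
      ∃ A : Set Ω, MeasurableSet A ∧ ENNReal.ofReal (1 - δ) ≤ μ A ∧
        ∀ ω ∈ A, ∀ t ≤ T, ∀ N, 1 ≤ N → ∀ (ξ : Vec d) (u : Vec m),
          πmin ≤ contextDensity (J t) ξ → J t (u, ξ) = 0 →
          condKDE (fun i => s t i ω) N (hu N) (hξ N) ξ u ≤ Real.sqrt C₀ * rate (m + d) N := by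
  obtain ⟨E, hE, hdev⟩ := exists_deviation_event m d hm L R ha hab
    (δ := δ / (T + 1)) (by positivity)
  set S : ℝ := 2 * E / πmin + (a ^ m)⁻¹ * (2 * E / πmin) ^ (m + 1) with hS
  have hS0 : 0 < S := by positivity
  refine ⟨S ^ 2, by positivity, ?_⟩
  intro Ω _ μ _ J s hu hξ hJ hs hhu hhξ
  have hD : ∀ t : ℕ, ∃ D : Set Ω, MeasurableSet D ∧ μ D ≤ ENNReal.ofReal (δ / (T + 1)) ∧
      (t ≤ T → ∀ ω ∉ D, (∀ i, ‖s t i ω‖ ≤ R) ∧ ∀ N, 1 ≤ N → ∀ z : Vec m × Vec d, ‖z‖ ≤ R + 1 →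
        jointKDE (fun i => s t i ω) N (hu N) (hξ N) z.1 z.2 ≤ J t z + E * rate (m + d) N ∧
        contextDensity (J t) z.2 - E * rate (m + d) N
          ≤ contextKDE (fun i => s t i ω) N (hξ N) z.2) := by
    intro t
    by_cases ht : t ≤ T
    · obtain ⟨D, h1, h2, h3⟩ := hdev μ (J t) (s t) hu hξ (hJ t ht) (hs t ht) hhu hhξ
      exact ⟨D, h1, h2, fun _ => h3⟩
    · exact ⟨∅, MeasurableSet.empty, by simp, fun h => absurd h ht⟩
  choose D hDm hDμ hDω using hD
  refine ⟨(⋃ t ∈ Finset.range (T + 1), D t)ᶜ,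
    ((Finset.range (T + 1)).measurableSet_biUnion fun t _ => hDm t).compl, ?_, ?_⟩
  · have hle : μ (⋃ t ∈ Finset.range (T + 1), D t) ≤ ENNReal.ofReal δ := by
      refine (measure_biUnion_finset_le _ _).trans
        ((Finset.sum_le_sum fun t _ => hDμ t).trans_eq ?_)
      rw [Finset.sum_const, Finset.card_range, nsmul_eq_mul, ← ENNReal.ofReal_natCast,
        ← ENNReal.ofReal_mul (by positivity)]
      congr 1
      push_cast
      field_simp
    rw [prob_compl_eq_one_sub
      ((Finset.range (T + 1)).measurableSet_biUnion fun t _ => hDm t), ENNReal.ofReal_sub _ hδ.le,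
      ENNReal.ofReal_one]
    exact tsub_le_tsub_left hle 1
  · intro ω hω t ht N hN ξ u hξπ h0
    have hωt : ω ∉ D t := fun h => hω (Set.mem_biUnion (by simpa using Nat.lt_succ_of_le ht) h)
    obtain ⟨hsR, hall⟩ := hDω t ht ω hωt
    have hw0 := rate_pos (m + d) hN
    have hbu := hhu N hN
    have hbξ := hhξ N hN
    change a * rate (m + d) N ≤ _ ∧ _ at hbu
    change a * rate (m + d) N ≤ _ ∧ _ at hbξ
    set w := rate (m + d) N with hw
    have haw : 0 < a * w := by positivity
    have hhu0 : 0 < hu N := haw.trans_le hbu.1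
    have hhξ0 : 0 < hξ N := haw.trans_le hbξ.1
    have hξR := norm_context_le (hJ t ht) (hπ.trans_le hξπ)
    rw [Real.sqrt_sq hS0.le, hS, add_mul]
    have p1 : 0 ≤ 2 * E / πmin * w := by positivity
    have p2 : 0 ≤ (a ^ m)⁻¹ * (2 * E / πmin) ^ (m + 1) * w := by positivity
    rcases le_or_gt (E * w) (πmin / 2) with hsmall | hlarge
    · have hnum := jointKDE_le_of_eq_zero (hJ t ht) hhu0 hhξ0 hsR
        (fun z hz => (hall N hN z hz).1) hξR h0
      have hden := (hall N hN (0, ξ) (by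
        rw [Prod.norm_mk, norm_zero]
        exact max_le (by linarith [(hJ t ht).radius_nonneg]) (by linarith))).2
      have hden' : πmin / 2 ≤ ∫ v : Vec m, jointKDE (fun i => s t i ω) N (hu N) (hξ N) v ξ := by
        rw [integral_jointKDE hhu0]
        change _ ≤ contextKDE (fun i => s t i ω) N (hξ N) ξ
        simp only at hden
        linarith
      have : condKDE (fun i => s t i ω) N (hu N) (hξ N) ξ u ≤ 2 * E / πmin * w := by
        rw [condKDE, div_le_iff₀ (by linarith)]
        calc _ ≤ E * w := hnum
          _ = 2 * E / πmin * w * (πmin / 2) := by field_simp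
          _ ≤ _ := mul_le_mul_of_nonneg_left hden' p1
      linarith
    · have h1 : 1 ≤ 2 * E / πmin * w := by
        rw [div_mul_eq_mul_div, one_le_div hπ]
        linarith
      have h2 := condKDE_le (s := fun i => s t i ω) hN haw hbu.1 hhξ0 ξ u
      have h3 : ((a * w) ^ m)⁻¹ ≤ (a ^ m)⁻¹ * (2 * E / πmin) ^ (m + 1) * w := by
        rw [mul_pow, mul_inv, mul_assoc]
        refine mul_le_mul_of_nonneg_left ?_ (by positivity)
        rw [inv_le_iff_one_le_mul₀ (by positivity)]
        calc (1 : ℝ) ≤ (2 * E / πmin * w) ^ (m + 1) := one_le_pow₀ h1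
          _ = _ := by rw [mul_pow, pow_succ w]; ring
      linarith


/-! ### The safety bound -/

/-- The learned basin lies in the interior of the feasible set. -/
lemma basin_subset {m d : ℕ} {J : Vec m × Vec d → ℝ} {ξ : Vec d} {p : Vec m → ℝ}
    {S M : Set (Vec m)} {α e πmin : ℝ} (hπ : 0 < πmin) (hξ : πmin ≤ contextDensity J ξ)
    (hM : IsFeasibilityDensity (condDensity J ξ) M) (hS : IsLocallyLogConcave p α S) (he : e < α)
    (hp : ∀ u, J (u, ξ) = 0 → p u ≤ e) : S ⊆ interior M := by
  intro u hu
  by_contra hcon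
  have h0 := hM.eq_zero u hcon
  rw [condDensity, div_eq_zero_iff] at h0
  have hle := hp u (h0.resolve_right (hπ.trans_le hξ).ne')
  obtain ⟨z, _, rfl⟩ := hS.component
  have hα : u ∈ {u | α ≤ p u} := connectedComponentIn_subset _ _ hu
  rw [Set.mem_ofPred_eq] at hα
  linarith

end PPC

theorem mainTheorem1
    (m d T : ℕ) (hm : 0 < m)
    (δ : ℝ) (hδ0 : 0 < δ) (hδ1 : δ < 1)
    (L R πmin a b : ℝ) (hπ : 0 < πmin) (ha : 0 < a) (hab : a ≤ b) :
    -- the constant of the error rate depends only on the parameters above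
    ∃ C₀ : ℝ, 0 < C₀ ∧
    ∀ (Ω : Type*) [MeasurableSpace Ω] (μ : MeasureTheory.Measure Ω)
      [MeasureTheory.IsProbabilityMeasure μ]
      (J : ℕ → PPC.Vec m × PPC.Vec d → ℝ) (s : ℕ → ℕ → Ω → PPC.Vec m × PPC.Vec d)
      (hu hξ : ℕ → ℝ),
      (∀ t ≤ T, PPC.IsJointOracleDensity (J t) L R) →
      (∀ t ≤ T, PPC.IsSampleStream μ (s t) (J t)) →
      PPC.IsBandwidth (m + d) a b hu →
      PPC.IsBandwidth (m + d) a b hξ →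
      -- with probability at least `1 - δ`, all of the following holds
      ∃ A : Set Ω, MeasurableSet A ∧ ENNReal.ofReal (1 - δ) ≤ μ A ∧
      ∀ ω ∈ A,
      ∀ (n : ℕ) (X Xsafe : Set (PPC.Vec n)) (U : Set (PPC.Vec m))
        (f : ℕ → PPC.Vec n → PPC.Vec m → PPC.Vec n) (x : ℕ → PPC.Vec n) (ξ : ℕ → PPC.Vec d)
        (N : ℕ → ℕ) (C α Lc Gc : ℝ) (K : ℕ) (c : ℕ → PPC.Vec m → ℝ) (β : ℕ → ℝ)
        (τ cb rb : ℕ → ℝ) (Mhat : ℕ → Set (PPC.Vec m)) (ubar ustar u : ℕ → PPC.Vec m),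
      ∀ (M : ℕ → Set (PPC.Vec m)) (pstar phat : ℕ → PPC.Vec m → ℝ) (ε ρ : ℕ → ℝ),
      M = (fun t => PPC.feasibleSet U (f t) Xsafe (x t)) →
      pstar = (fun t => PPC.condDensity (J t) (ξ t)) →
      phat = (fun t => PPC.condKDE (fun i => s t i ω) (N t) (hu (N t)) (hξ (N t)) (ξ t)) →
      ε = (fun t => PPC.errorRate (m + d) C (N t)) →
      ρ = (fun t => PPC.contractionFactor (phat t) (Mhat t) (β t) Lc K) →
      C₀ ≤ C → 0 < α → 0 ≤ Lc →
      -- closed loop: sample counts, states, and outputs warm-started from the previous action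
      (∀ t ≤ T, 1 ≤ N t) →
      (∀ t ≤ T, x t ∈ X) →
      (∀ t < T, x (t + 1) = f t (x t) (u t)) →
      (∀ t < T, u (t + 1) = PPC.ppcOutput (c (t + 1)) (β (t + 1)) (phat (t + 1)) (Mhat (t + 1))
        Lc K (u t)) →
      -- regularity of the safe set and of the dynamics, and the oracle feasibility density
      Xsafe ⊆ X → IsCompact Xsafe →
      (∀ t ≤ T, ContDiffOn ℝ 2 (fun z : PPC.Vec n × PPC.Vec m => f t z.1 z.2) (X ×ˢ U)) →
      (∀ t ≤ T, IsCompact (M t)) →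
      (∀ t ≤ T, πmin ≤ PPC.contextDensity (J t) (ξ t)) →
      (∀ t ≤ T, PPC.IsFeasibilityDensity (pstar t) (M t)) →
      -- local log-concavity on a single basin, and the cost
      (∀ t ≤ T, PPC.IsLocallyLogConcave (phat t) α (Mhat t)) →
      (∀ t ≤ T, PPC.IsSmoothConvexCost (c t) U Lc Gc) →
      -- density peak and restricted minimizer of the free energy
      (∀ t ≤ T, ubar t ∈ Mhat t ∧ IsMaxOn (phat t) (Mhat t) (ubar t)) →
      (∀ t ≤ T, ustar t ∈ Mhat t ∧
        IsMinOn (PPC.freeEnergy (c t) (β t) (phat t)) (Mhat t) (ustar t)) →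
      -- stiffness
      (∀ t ≤ T, 0 < PPC.levelRadius (Mhat t) (ubar t)) →
      (∀ t ≤ T, PPC.criticalStiffness (phat t) (Mhat t) (ubar t) Gc < β t) →
      -- inward-normal nondegeneracy and smallness
      (∀ t ≤ T, 0 < cb t ∧ 0 < rb t ∧ rb t ≤ τ t ∧ PPC.HasReach (frontier (M t)) (τ t) ∧
        PPC.InwardNondegenerate (pstar t) (M t) (cb t) (rb t)) →
      (∀ t ≤ T, Real.sqrt (ε t) < α ∧ (α + Real.sqrt (ε t)) / cb t ≤ rb t) →
      -- warm-start margin and enough inner steps: the safety bound at all times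
      ((∃ Rstar : ℝ, 0 < Rstar ∧
          (∀ t ≤ T, Rstar ≤ PPC.interiorMargin (phat t) (Mhat t) (ubar t) (β t) Gc) ∧
          ‖u 0 - ustar 0‖ ≤ Rstar / 2 ∧
          (∀ t < T, ‖ustar (t + 1) - ustar t‖ ≤ Rstar / 2)) →
        (∀ t, 1 ≤ t → t ≤ T → ρ t ≤ 1 / 2) →
        ∀ t, 1 ≤ t → t ≤ T →
          Metric.infDist (u t) (M t) ≤
            PPC.safetyBound (phat t) (Mhat t) (ε t) α (cb t) (β t) Gc) ∧
      -- arbitrary finite `K`, warm start in the attraction ball: the bound with the remainder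
      (∀ t < T,
        u t ∈ Mhat (t + 1) →
        ‖u t - ustar (t + 1)‖ ≤ Metric.infDist (ustar (t + 1)) (frontier (Mhat (t + 1))) →
          Metric.infDist (u (t + 1)) (M (t + 1)) ≤
            PPC.safetyBound (phat (t + 1)) (Mhat (t + 1)) (ε (t + 1)) α (cb (t + 1))
                (β (t + 1)) Gc
              + ρ (t + 1) * Metric.diam (Mhat (t + 1))) := by
  obtain ⟨C₀, hC₀, hev⟩ := PPC.exists_safe_event m d T hm hδ0 L R hπ ha hab
  refine ⟨C₀, hC₀, ?_⟩
  intro Ω _ μ _ J s hu hξ hJ hs hhu hhξ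
  obtain ⟨A, hAm, hAμ, hA⟩ := hev μ J s hu hξ hJ hs hhu hhξ
  refine ⟨A, hAm, hAμ, ?_⟩
  intro ω hω n X Xsafe U f x ξ N C α Lc Gc K c β τ cb rb Mhat ubar ustar u M pstar phat ε ρ hMdef
    hpstar hphat hε hρ hC hα hLc hN _ _ hstep _ _ _ _ hπξ hfeas hconc hcost hpeak hmin hrad hstiff
    hnondeg hsmall
  have hsub : ∀ t ≤ T, Mhat t ⊆ interior (M t) := by
    intro t ht
    have hfe := hfeas t ht
    have hsm := (hsmall t ht).1
    simp only [hpstar] at hfe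
    simp only [hε] at hsm
    refine PPC.basin_subset hπ (hπξ t ht) hfe (hconc t ht) hsm fun v hv => ?_
    simp only [hphat]
    exact (hA ω hω t ht (N t) (hN t ht) (ξ t) v (hπξ t ht) hv).trans
      (PPC.sqrt_mul_rate_le (hN t ht) hC)
  have hMU : ∀ t, M t ⊆ U := fun t v hv => by
    simp only [hMdef] at hv
    exact hv.1
  have hbasin : ∀ t ≤ T, PPC.IsBasin (phat t) (c t) α (β t) Lc Gc (Mhat t) U (ubar t)
      (ustar t) := by
    intro t ht
    have hw0 := mul_pos ha (PPC.rate_pos (m + d) (hN t ht))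
    refine ⟨?_, ?_, hconc t ht, hcost t ht, ((hsub t ht).trans interior_subset).trans (hMU t),
      hpeak t ht, hmin t ht, hrad t ht, hstiff t ht⟩
    · simp only [hphat]
      exact PPC.contDiff_condKDE _
    · intro v
      simp only [hphat]
      exact PPC.condKDE_pos (hN t ht) (hw0.trans_le (hhu _ (hN t ht)).1)
        (hw0.trans_le (hhξ _ (hN t ht)).1) _ _
  have hdist : ∀ t ≤ T, ∀ v ∈ Mhat t, Metric.infDist v (M t) = 0 := fun t ht v hv =>
    Metric.infDist_zero_of_mem (interior_subset (hsub t ht hv))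
  have hbound : ∀ t ≤ T,
      0 ≤ PPC.safetyBound (phat t) (Mhat t) (ε t) α (cb t) (β t) Gc := fun t ht =>
    (hbasin t ht).safetyBound_nonneg hα (hnondeg t ht).1
  constructor
  · rintro ⟨Rs, hRs, hmargin, h0, hdrift⟩ hhalf
    -- each step starts within `Rs` of the current minimizer and ends within `Rs / 2` of it
    have hwarm : ∀ t < T, ‖u t - ustar t‖ ≤ Rs / 2 →
        ‖u t - ustar (t + 1)‖ ≤ Rs ∧ ‖u t - ustar (t + 1)‖
          ≤ Metric.infDist (ustar (t + 1)) (frontier (Mhat (t + 1))) := by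
      intro t ht htr
      have h1 : ‖u t - ustar (t + 1)‖ ≤ Rs := by
        have h2 := norm_sub_le_norm_sub_add_norm_sub (u t) (ustar t) (ustar (t + 1))
        have h3 := hdrift t ht
        rw [norm_sub_rev] at h3
        linarith
      exact ⟨h1, h1.trans ((hmargin (t + 1) ht).trans
        (hbasin (t + 1) ht).interiorMargin_le_infDist)⟩
    have htrack : ∀ t ≤ T, ‖u t - ustar t‖ ≤ Rs / 2 := by
      intro t
      induction t with
      | zero => exact fun _ => h0
      | succ t ih =>
        intro ht
        obtain ⟨h1, h2⟩ := hwarm t ht (ih (Nat.le_of_succ_le ht))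
        have h3 := ((hbasin (t + 1) ht).norm_ppcOutput_sub_le hm hLc K h2).1
        have h4 := hhalf (t + 1) (Nat.le_add_left 1 t) ht
        simp only [hρ] at h4
        rw [hstep t ht]
        have h5 := mul_le_mul h4 h1 (norm_nonneg _) (by norm_num)
        linarith
    intro t ht1 htT
    obtain ⟨t, rfl⟩ : ∃ k, t = k + 1 := ⟨t - 1, by omega⟩
    obtain ⟨_, h2⟩ := hwarm t htT (htrack t (Nat.le_of_succ_le htT))
    have hmem := (hbasin (t + 1) htT).ppcOutput_mem hm hLc K h2
    rw [← hstep t htT] at hmem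
    rw [hdist _ htT _ hmem]
    exact hbound _ htT
  · intro t ht _ hball
    have hmem := (hbasin (t + 1) ht).ppcOutput_mem hm hLc K hball
    rw [← hstep t ht] at hmem
    rw [hdist _ ht _ hmem]
    have hρ0 : 0 ≤ ρ (t + 1) := by
      simp only [hρ]
      exact (hbasin (t + 1) ht).contractionFactor_nonneg hm hLc K
    exact add_nonneg (hbound _ ht) (mul_nonneg hρ0 Metric.diam_nonneg)
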